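/- Let $y_j=\theta_j+\sigma\xi_j$, $j=1,\dots,d$, where $\theta\in\mathbb R^d$ is unknown, $\sigma>0$, and the $\xi_j$ are i.i.d. standard normal; $\mathbf E_\theta$ is the expectation under the law of $y=(y_1,\dots,y_d)$. For $q,r>0$ let $\|\theta\|_q=\big(\sum_{j=1}^d|\theta_j|^q\big)^{1/q}$ and $B_q(r)=\{\theta\in\mathbb R^d:\|\theta\|_q\le r\}$, and let $$R^*=\inf_{\hat T}\ \sup_{\theta\in B_q(r)}\mathbf E_\theta(\hat T-\|\theta\|_2)^2$$ be the minimax risk, the infimum being over all estimators, i.e. all measurable functions $\hat T=\hat T(y)$. Let $m=m(d,r,\sigma,q)$ be the largest integer $s\ge1$ such that $$\sigma^2\log(1+d/k^2)\le r^2k^{-2/q}\qquad\text{for all integers } 1\le k\le s,$$ with $m=0$ if the inequality fails for $k=1$ and $m=\infty$ if it holds for all $k\ge1$. (For $q\le1$ the integers that satisfy the inequality form an initial segment of $\{1,2,\dots\}$, so that $m$ is the largest integer satisfying it.) Put $$\psi=\begin{cases}\sigma^2\sqrt d & \text{if } m>\sqrt d,\\ \sigma^2m\log(1+d/m^2)&\text{if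 }1\le m\le\sqrt d,\\ r^2&\text{if } m=0,\end{cases}$$ $$\hat Q_q=\begin{cases}\sum_{j=1}^d y_j^2-d\sigma^2&\text{if } m>\sqrt d,\\ \sum_{j=1}^d (y_j^2-\tilde\alpha_m\sigma^2)\,\mathbf 1_{\{|y_j|>2\sigma\sqrt{2\log(1+d/m^2)}\}}&\text{if }1\le m\le\sqrt d,\\ 0&\text{if } m=0,\end{cases}$$ where $\tilde\alpha_m=\mathbf E\big(X^2\mid X^2>8\log(1+d/m^2)\big)$ with $X$ standard normal, and let $\hat N_q=\sqrt{\max(\hat Q_q,0)}$. Theorem. Let $0<q<2$. There exist constants $C,c>0$, depending only on $q$, such that for every integer $d\ge1$ and all $r,\sigma>0$ the statistic $\hat N_q$ is measurable, $$\sup_{\theta\in B_q(r)}\mathbf E_\theta(\hat N_q-\|\theta\|_2)^2\le C\,\psi,\qquad\text{and}\qquad R^*\ge c\,\psi .$$ -/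

import Mathlib

open MeasureTheory ProbabilityTheory
open scoped ENNReal

namespace SparseNorm

noncomputable section

/-- The law `P_θ` of the observations `y_j = θ_j + σ ξ_j`, `j = 1, …, d`, where the `ξ_j` are
i.i.d. standard normal. -/
def obsLaw {d : ℕ} (σ : ℝ) (θ : Fin d → ℝ) : Measure (Fin d → ℝ) :=
  (Measure.pi fun _ : Fin d => gaussianReal 0 1).map fun ξ j => θ j + σ * ξ j

/-- `‖θ‖_q = (∑ |θ_j|^q)^(1/q)`. -/
def lqNorm {d : ℕ} (q : ℝ) (θ : Fin d → ℝ) : ℝ :=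
  (∑ j, |θ j| ^ q) ^ (1 / q)

/-- The class `B_q(r)` in `ℝ^d`. -/
def lqBall (d : ℕ) (q r : ℝ) : Set (Fin d → ℝ) :=
  {θ | lqNorm q θ ≤ r}

/-- The functional `‖θ‖_2 = √(∑ θ_j²)`. -/
def l2Norm {d : ℕ} (θ : Fin d → ℝ) : ℝ :=
  √(∑ j, θ j ^ 2)

/-- The squared risk `E_θ (T̂ - T(θ))²`, as an element of `[0, ∞]`. -/
def sqRisk {d : ℕ} (σ : ℝ) (T : (Fin d → ℝ) → ℝ) (That : (Fin d → ℝ) → ℝ)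
    (θ : Fin d → ℝ) : ℝ≥0∞ :=
  ∫⁻ y, ENNReal.ofReal ((That y - T θ) ^ 2) ∂(obsLaw σ θ)

/-- The maximum squared risk over a class `Θ`. -/
def maxRisk {d : ℕ} (σ : ℝ) (T : (Fin d → ℝ) → ℝ) (Θ : Set (Fin d → ℝ))
    (That : (Fin d → ℝ) → ℝ) : ℝ≥0∞ :=
  ⨆ θ ∈ Θ, sqRisk σ T That θ

/-- The minimax risk: the infimum of the maximum risk over all estimators, that is, over all
measurable functions of the observations. -/
def minimaxRisk {d : ℕ} (σ : ℝ) (T : (Fin d → ℝ) → ℝ) (Θ : Set (Fin d → ℝ)) : ℝ≥0∞ :=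
  ⨅ (That : (Fin d → ℝ) → ℝ) (_ : Measurable That), maxRisk σ T Θ That

/-- The inequality `σ² log (1 + d / s²) ≤ r² s^(-2/q)`. -/
def SparsityIneq (d : ℕ) (q r σ : ℝ) (s : ℕ) : Prop :=
  σ ^ 2 * Real.log (1 + d / (s : ℝ) ^ 2) ≤ r ^ 2 * (s : ℝ) ^ (-2 / q)

/-- The effective sparsity `m`: the largest `s ≥ 1` such that `SparsityIneq` holds at all of
`1, …, s`; it is `0` if `SparsityIneq` fails at `1`, and `⊤` if it never fails.
For `q ≤ 1` the left side of `SparsityIneq` times `s^(2/q)` is increasing in `s`, and `m` is just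
the largest `s ≥ 1` for which `SparsityIneq` holds. For `q > 1` it holds for all large `s`. -/
def effSparsity (d : ℕ) (q r σ : ℝ) : ℕ∞ :=
  ⨆ (s : ℕ) (_ : ∀ k : ℕ, 1 ≤ k → k ≤ s → SparsityIneq d q r σ k), (s : ℕ∞)

open Classical in
/-- The rate: `σ² √d` if `m > √d` (that is, `d < m²`), `σ² m log (1 + d / m²)` if `1 ≤ m ≤ √d`,
and `r²` if `m = 0`. -/
def rate (d : ℕ) (q r σ : ℝ) : ℝ :=
  if (d : ℕ∞) < effSparsity d q r σ ^ 2 then σ ^ 2 * √(d : ℝ)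
  else if 1 ≤ effSparsity d q r σ then
    σ ^ 2 * ((effSparsity d q r σ).toNat : ℝ) *
      Real.log (1 + d / ((effSparsity d q r σ).toNat : ℝ) ^ 2)
  else r ^ 2

/-- `E (X² | X² > 8 log (1 + d / m²))` for a standard normal `X`. -/
def condSecondMoment (d m : ℕ) : ℝ :=
  ∫ x, x ^ 2 ∂(ProbabilityTheory.cond (gaussianReal 0 1)
    {x : ℝ | 8 * Real.log (1 + d / (m : ℝ) ^ 2) < x ^ 2})

open Classical in
/-- The statistic `Q̂_q`. -/
def quadStat (d : ℕ) (q r σ : ℝ) (y : Fin d → ℝ) : ℝ :=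
  if (d : ℕ∞) < effSparsity d q r σ ^ 2 then (∑ j, y j ^ 2) - d * σ ^ 2
  else if 1 ≤ effSparsity d q r σ then
    ∑ j, if 2 * σ * √(2 * Real.log (1 + d / ((effSparsity d q r σ).toNat : ℝ) ^ 2)) < |y j|
      then y j ^ 2 - condSecondMoment d (effSparsity d q r σ).toNat * σ ^ 2
      else 0
  else 0

/-- The estimator `N̂_q = √(max (Q̂_q, 0))`. -/
def normStat (d : ℕ) (q r σ : ℝ) (y : Fin d → ℝ) : ℝ :=
  √(max (quadStat d q r σ y) 0)

end

end SparseNorm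

/-! Everything is done in units of `σ`: `y = σ x`, `θ = σ t`, with unit variance for `x`. Write `L =
log (1 + d / m²)`.

Lower bound. The zero vector is tested against `k` spikes of height `σ a`, one uniformly placed in
each of `k` disjoint blocks of size `n = ⌊d / k⌋`. All spike vectors have the same norm `ρ = σ a
√k`, and the likelihood ratio of the mixture has second moment `(1 + (exp (a²) - 1) / n) ^ k`. This
is at most `2` when `a² ≤ log (1 + d / k²) / 4` and `k² ≤ d` (`second_moment_le`), and then
`le_of_mixture` gives risk at least `ρ² / 6`. The spikes lie in the ball by the sparsity inequality
at `k`. The choices are `k = m`, `k = ⌊√d⌋`, and, for `m = 0`, `k = 1` with `a = r / (2σ)`.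

Upper bound. If `Z` estimates `T²` with mean square error at most `K (A² + A T²)`, then `√Z₊`
estimates `T` with mean square error at most `2 K A` (`lintegral_sqrt_posPart_sub_sq_le`). For `m >
√d`, the unbiased chi-square statistic satisfies this with `A = √d`. For `1 ≤ m ≤ √d`, `A = m L`. A
thresholded coordinate has bias of order `min (t², L)` and variance of order `L² exp (-L) + L t²`
(`tunedStat_bias`, `tunedStat_variance`). The variances sum to the right order because `d exp (-L) ≤
m²`, the biases because failure of the sparsity inequality at `m + 1` forces `∑ min (t_j², L) ≤ (m +
1) L` on the ball (`sum_min_le_of_mem`). For `m = 0`, the estimator `0` suffices, as `‖θ‖_2 ≤ r`.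

Only the inequality at `m` and its failure at `m + 1` enter in the sparse regime, so no monotonicity
in `s` is needed and all `q < 2` are covered. -/

namespace SparseNorm

/-! ### Shifted Gaussian laws and their likelihood ratios -/

/-- The law of a standard Gaussian vector shifted by `t`. -/
noncomputable def shiftLaw {d : ℕ} (t : Fin d → ℝ) : Measure (Fin d → ℝ) :=
  Measure.pi fun j => gaussianReal (t j) 1

instance {d : ℕ} (t : Fin d → ℝ) : IsProbabilityMeasure (shiftLaw t) := by
  unfold shiftLaw; infer_instance

/-- The likelihood ratio of `shiftLaw t` with respect to `shiftLaw 0`. -/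
noncomputable def likelihood {d : ℕ} (t x : Fin d → ℝ) : ℝ :=
  Real.exp (∑ j, (t j * x j - t j ^ 2 / 2))

lemma measurable_likelihood {d : ℕ} (t : Fin d → ℝ) : Measurable (likelihood t) := by
  unfold likelihood; fun_prop

lemma likelihood_nonneg {d : ℕ} (t x : Fin d → ℝ) : 0 ≤ likelihood t x := (Real.exp_pos _).le

lemma likelihood_mul {d : ℕ} (s t x : Fin d → ℝ) :
    likelihood s x * likelihood t x
      = Real.exp (∑ j, s j * t j) * likelihood (fun j => s j + t j) x := by
  simp only [likelihood, ← Real.exp_add, ← Finset.sum_add_distrib]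
  congr 1
  refine Finset.sum_congr rfl fun j _ => ?_
  ring

lemma obsLaw_mul {d : ℕ} (σ : ℝ) (t : Fin d → ℝ) :
    obsLaw σ (fun j => σ * t j) = (shiftLaw t).map fun x j => σ * x j := by
  have h : shiftLaw t = (Measure.pi fun _ : Fin d => gaussianReal 0 1).map
      fun ξ j => t j + ξ j := by
    rw [Measure.pi_map_pi (f := fun j x => t j + x) fun j => by fun_prop]
    simp [gaussianReal_map_const_add, shiftLaw]
  rw [h, Measure.map_map (by fun_prop) (by fun_prop), obsLaw]
  congr 1
  ext ξ j
  simp [mul_add]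

lemma sqRisk_mul {d : ℕ} (σ : ℝ) (T That : (Fin d → ℝ) → ℝ) (hT : Measurable That)
    (t : Fin d → ℝ) :
    sqRisk σ T That (fun j => σ * t j)
      = ∫⁻ x, ENNReal.ofReal ((That (fun j => σ * x j) - T (fun j => σ * t j)) ^ 2)
          ∂(shiftLaw t) := by
  rw [sqRisk, obsLaw_mul, lintegral_map (by fun_prop) (by fun_prop)]

lemma gaussianReal_eq_withDensity (t : ℝ) :
    gaussianReal t 1 = (gaussianReal 0 1).withDensity
      fun x => ENNReal.ofReal (Real.exp (t * x - t ^ 2 / 2)) := by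
  rw [gaussianReal_of_var_ne_zero _ one_ne_zero, gaussianReal_of_var_ne_zero _ one_ne_zero,
    ← withDensity_mul _ (measurable_gaussianPDF 0 1) (by fun_prop)]
  congr 1
  ext x
  simp only [gaussianPDF, Pi.mul_apply]
  rw [← ENNReal.ofReal_mul (gaussianPDFReal_nonneg _ _ _)]
  congr 1
  simp only [gaussianPDFReal, mul_assoc, ← Real.exp_add]
  congr 2
  simp
  ring

lemma shiftLaw_eq_withDensity {d : ℕ} (t : Fin d → ℝ) :
    shiftLaw t = (shiftLaw 0).withDensity fun x => ENNReal.ofReal (likelihood t x) := by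
  unfold shiftLaw
  refine (Measure.pi_eq fun s hs => ?_)
  rw [withDensity_apply _ (MeasurableSet.univ_pi hs), ← lintegral_indicator
    (MeasurableSet.univ_pi hs)]
  have h1 : (Set.univ.pi s).indicator (fun x => ENNReal.ofReal (likelihood t x))
      = fun x => ∏ j, (s j).indicator
        (fun y => ENNReal.ofReal (Real.exp (t j * y - t j ^ 2 / 2))) (x j) := by
    ext x
    by_cases hx : x ∈ Set.univ.pi s
    · rw [Set.indicator_of_mem hx, likelihood, Real.exp_sum,
        ENNReal.ofReal_prod_of_nonneg fun _ _ => (Real.exp_pos _).le]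
      refine Finset.prod_congr rfl fun j _ => ?_
      rw [Set.indicator_of_mem (hx j (Set.mem_univ j))]
    · rw [Set.indicator_of_notMem hx]
      simp only [Set.mem_pi, Set.mem_univ, true_implies, not_forall] at hx
      obtain ⟨j, hj⟩ := hx
      rw [Finset.prod_eq_zero (Finset.mem_univ j)]
      rw [Set.indicator_of_notMem hj]
  have hm : ∀ j, Measurable ((s j).indicator
        (fun y => ENNReal.ofReal (Real.exp (t j * y - t j ^ 2 / 2)))) := fun j =>
    Measurable.indicator (by fun_prop) (hs j)
  rw [h1, lintegral_prod_eq_prod_lintegral_of_indepFun Finset.univ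
    (fun j (x : Fin d → ℝ) => (s j).indicator
        (fun y => ENNReal.ofReal (Real.exp (t j * y - t j ^ 2 / 2))) (x j))
    (iIndepFun_pi fun j => (hm j).aemeasurable)
    (fun j => (hm j).comp (measurable_pi_apply j))]
  refine Finset.prod_congr rfl fun j _ => ?_
  rw [gaussianReal_eq_withDensity, withDensity_apply _ (hs j), ← lintegral_indicator (hs j)]
  exact (measurePreserving_eval (fun j => gaussianReal ((0 : Fin d → ℝ) j) 1) j).lintegral_comp
    (hm j)

lemma lintegral_likelihood {d : ℕ} (t : Fin d → ℝ) :
    ∫⁻ x, ENNReal.ofReal (likelihood t x) ∂(shiftLaw 0) = 1 := by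
  have h := measure_univ (μ := shiftLaw t)
  rwa [shiftLaw_eq_withDensity, withDensity_apply _ MeasurableSet.univ,
    Measure.restrict_univ] at h

lemma lintegral_likelihood_mul {d : ℕ} (s t : Fin d → ℝ) :
    ∫⁻ x, ENNReal.ofReal (likelihood s x * likelihood t x) ∂(shiftLaw 0)
      = ENNReal.ofReal (Real.exp (∑ j, s j * t j)) := by
  simp_rw [likelihood_mul, ENNReal.ofReal_mul (Real.exp_pos _).le]
  rw [lintegral_const_mul _ (measurable_likelihood _).ennreal_ofReal, lintegral_likelihood,
    mul_one]

/-! ### Minimax lower bound by a mixture of sparse vectors -/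

/-- Minimising over `S` leaves `ρ² F / (1 + F)`, and `1 / (1 + F) ≥ 5 / 9 - F / 9` is the tangent
line at `F = 2`. Only `E F` and `E F²` are needed after integration. -/
lemma mixture_pointwise {S ρ F : ℝ} (hF : 0 ≤ F) :
    5 / 9 * ρ ^ 2 * F ≤ S ^ 2 + (S - ρ) ^ 2 * F + ρ ^ 2 / 9 * F ^ 2 := by
  have h : 0 < 1 + F := by linarith
  have key : (1 + F) * (S ^ 2 + (S - ρ) ^ 2 * F + ρ ^ 2 / 9 * F ^ 2 - 5 / 9 * ρ ^ 2 * F)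
      = ((1 + F) * S - ρ * F) ^ 2 + ρ ^ 2 / 9 * F * (2 - F) ^ 2 := by ring
  have : 0 ≤ (1 + F) * (S ^ 2 + (S - ρ) ^ 2 * F + ρ ^ 2 / 9 * F ^ 2 - 5 / 9 * ρ ^ 2 * F) := by
    rw [key]; positivity
  linarith [nonneg_of_mul_nonneg_right this h]

/-- Lower bound for testing-type problems against a mixture with bounded second moment of the
likelihood ratio. -/
lemma le_of_mixture {d : ℕ} {Ω : Type*} [Fintype Ω] [Nonempty Ω] (t : Ω → Fin d → ℝ)
    {S : (Fin d → ℝ) → ℝ} (hS : Measurable S) {ρ : ℝ} {R : ℝ≥0∞}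
    (h0 : ∫⁻ x, ENNReal.ofReal (S x ^ 2) ∂(shiftLaw 0) ≤ R)
    (h1 : ∀ ω, ∫⁻ x, ENNReal.ofReal ((S x - ρ) ^ 2) ∂(shiftLaw (t ω)) ≤ R)
    (hM : ∑ ω, ∑ ω', Real.exp (∑ j, t ω j * t ω' j) ≤ 2 * (Fintype.card Ω : ℝ) ^ 2) :
    ENNReal.ofReal (ρ ^ 2 / 6) ≤ R := by
  set N : ℝ := (Fintype.card Ω : ℝ) with hN
  have hNpos : 0 < N := by rw [hN]; exact_mod_cast Fintype.card_pos
  set F : (Fin d → ℝ) → ℝ := fun x => N⁻¹ * ∑ ω, likelihood (t ω) x with hF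
  have hFm : Measurable F :=
    (Finset.measurable_sum _ fun ω _ => measurable_likelihood (t ω)).const_mul _
  have hF0 : ∀ x, 0 ≤ F x := fun x =>
    mul_nonneg (inv_pos.2 hNpos).le (Finset.sum_nonneg fun ω _ => likelihood_nonneg _ _)
  have lin : ∀ G : (Fin d → ℝ) → ℝ, Measurable G → (∀ x, 0 ≤ G x) →
      ∫⁻ x, ENNReal.ofReal (G x * F x) ∂(shiftLaw 0)
        = ENNReal.ofReal N⁻¹ * ∑ ω, ∫⁻ x, ENNReal.ofReal (G x) ∂(shiftLaw (t ω)) := by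
    intro G hG hG0
    have : ∀ x, ENNReal.ofReal (G x * F x)
        = ENNReal.ofReal N⁻¹ * ∑ ω, ENNReal.ofReal (likelihood (t ω) x) * ENNReal.ofReal (G x) := by
      intro x
      rw [← Finset.sum_mul, ← ENNReal.ofReal_sum_of_nonneg fun ω _ => likelihood_nonneg _ _,
        ← ENNReal.ofReal_mul (Finset.sum_nonneg fun ω _ => likelihood_nonneg _ _),
        ← ENNReal.ofReal_mul (inv_pos.2 hNpos).le]
      congr 1
      simp only [hF]; ring
    simp_rw [this]
    have hmul : ∀ ω, Measurable fun x =>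
        ENNReal.ofReal (likelihood (t ω) x) * ENNReal.ofReal (G x) := fun ω =>
      (measurable_likelihood _).ennreal_ofReal.mul hG.ennreal_ofReal
    rw [lintegral_const_mul _ (Finset.measurable_fun_sum _ fun ω _ => hmul ω),
      lintegral_finsetSum _ fun ω _ => hmul ω]
    congr 1
    refine Finset.sum_congr rfl fun ω _ => ?_
    rw [shiftLaw_eq_withDensity (t ω), lintegral_withDensity_eq_lintegral_mul _
      (measurable_likelihood _).ennreal_ofReal hG.ennreal_ofReal]
    rfl
  have avg : ∀ (a : Ω → ℝ≥0∞) (b : ℝ≥0∞), (∀ ω, a ω ≤ b) → ENNReal.ofReal N⁻¹ * ∑ ω, a ω ≤ b := by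
    intro a b hab
    calc ENNReal.ofReal N⁻¹ * ∑ ω, a ω ≤ ENNReal.ofReal N⁻¹ * ∑ _ω : Ω, b := by
          gcongr with ω; exact hab ω
      _ = (ENNReal.ofReal N⁻¹ * ENNReal.ofReal N) * b := by
          rw [Finset.sum_const, Finset.card_univ, nsmul_eq_mul, mul_assoc, hN,
            ENNReal.ofReal_natCast]
      _ = b := by
          rw [← ENNReal.ofReal_mul (inv_pos.2 hNpos).le, inv_mul_cancel₀ hNpos.ne']; simp
  have e1 : ∫⁻ x, ENNReal.ofReal ((S x - ρ) ^ 2 * F x) ∂(shiftLaw 0) ≤ R := by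
    rw [lin _ (by fun_prop) fun x => sq_nonneg _]
    exact avg _ _ h1
  have e2 : ∫⁻ x, ENNReal.ofReal (5 / 9 * ρ ^ 2 * F x) ∂(shiftLaw 0)
      = ENNReal.ofReal (5 / 9 * ρ ^ 2) := by
    rw [lin _ (by fun_prop) fun x => by positivity]
    simp only [lintegral_const, measure_univ, mul_one, Finset.sum_const, Finset.card_univ,
      nsmul_eq_mul]
    rw [← ENNReal.ofReal_natCast, ← hN, ← mul_assoc, ← ENNReal.ofReal_mul (inv_pos.2 hNpos).le,
      inv_mul_cancel₀ hNpos.ne']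
    simp
  have e3 : ∫⁻ x, ENNReal.ofReal (F x ^ 2) ∂(shiftLaw 0) ≤ ENNReal.ofReal 2 := by
    have hsq : ∀ x, ENNReal.ofReal (F x ^ 2) = ENNReal.ofReal (N⁻¹ ^ 2) *
        ∑ ω, ∑ ω', ENNReal.ofReal (likelihood (t ω) x * likelihood (t ω') x) := by
      intro x
      have hn : ∀ ω ω', 0 ≤ likelihood (t ω) x * likelihood (t ω') x := fun ω ω' =>
        mul_nonneg (likelihood_nonneg _ _) (likelihood_nonneg _ _)
      simp_rw [← ENNReal.ofReal_sum_of_nonneg fun ω' _ => hn _ ω']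
      rw [← ENNReal.ofReal_sum_of_nonneg fun ω _ => Finset.sum_nonneg fun ω' _ => hn ω ω',
        ← ENNReal.ofReal_mul (by positivity)]
      congr 1
      simp only [hF, mul_pow]
      rw [sq (∑ ω, likelihood (t ω) x), Finset.sum_mul_sum]
    have hmm : ∀ ω ω', Measurable fun x =>
        ENNReal.ofReal (likelihood (t ω) x * likelihood (t ω') x) := fun ω ω' =>
      ((measurable_likelihood _).mul (measurable_likelihood _)).ennreal_ofReal
    simp_rw [hsq]
    rw [lintegral_const_mul _ (Finset.measurable_fun_sum _ fun ω _ =>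
      Finset.measurable_fun_sum _ fun ω' _ => hmm ω ω'), lintegral_finsetSum _ fun ω _ =>
      Finset.measurable_fun_sum _ fun ω' _ => hmm ω ω']
    simp_rw [lintegral_finsetSum _ fun ω' _ => hmm _ ω', lintegral_likelihood_mul]
    simp_rw [← ENNReal.ofReal_sum_of_nonneg fun ω' _ => (Real.exp_pos _).le]
    rw [← ENNReal.ofReal_sum_of_nonneg fun ω _ => Finset.sum_nonneg fun ω' _ =>
        (Real.exp_pos _).le, ← ENNReal.ofReal_mul (by positivity)]
    apply ENNReal.ofReal_le_ofReal
    rw [inv_pow, inv_mul_le_iff₀ (by positivity)]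
    linarith
  have e4 : ∫⁻ x, ENNReal.ofReal (ρ ^ 2 / 9 * F x ^ 2) ∂(shiftLaw 0)
      ≤ ENNReal.ofReal (2 / 9 * ρ ^ 2) := by
    simp_rw [ENNReal.ofReal_mul (show 0 ≤ ρ ^ 2 / 9 by positivity)]
    rw [lintegral_const_mul _ (by fun_prop)]
    refine (mul_le_mul_right e3 _).trans (le_of_eq ?_)
    rw [← ENNReal.ofReal_mul (by positivity)]
    congr 1; ring
  -- With `E F = 1` and `E F² ≤ 2`, this says `(5/9 - 2/9) ρ² ≤ 2 R`, hence the constant `1/6`.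
  have main : ENNReal.ofReal (5 / 9 * ρ ^ 2) ≤ R + R + ENNReal.ofReal (2 / 9 * ρ ^ 2) := by
    rw [← e2]
    refine le_trans ?_ (add_le_add (add_le_add h0 e1) e4)
    rw [← lintegral_add_left (by fun_prop), ← lintegral_add_left (by fun_prop)]
    refine lintegral_mono fun x => ?_
    rw [← ENNReal.ofReal_add (by positivity) (mul_nonneg (sq_nonneg _) (hF0 x)),
      ← ENNReal.ofReal_add (add_nonneg (by positivity) (mul_nonneg (sq_nonneg _) (hF0 x)))
        (by positivity)]
    exact ENNReal.ofReal_le_ofReal (mixture_pointwise (hF0 x))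
  rcases eq_or_ne R ∞ with rfl | hR
  · exact le_top
  lift R to NNReal using hR
  rw [← ENNReal.ofReal_coe_nnreal, ← ENNReal.ofReal_add (by positivity) (by positivity),
    ← ENNReal.ofReal_add (by positivity) (by positivity),
    ENNReal.ofReal_le_ofReal_iff (by positivity)] at main
  rw [← ENNReal.ofReal_coe_nnreal]
  exact ENNReal.ofReal_le_ofReal (by linarith)

/-- The vector equal to `a` on the image of `p` and to `0` elsewhere. -/
noncomputable def spikes {d k : ℕ} (a : ℝ) (p : Fin k → Fin d) : Fin d → ℝ :=
  fun j => ∑ i, if p i = j then a else 0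

lemma sum_comp_spikes {d k : ℕ} {a : ℝ} {p : Fin k → Fin d} (hp : Function.Injective p)
    {G : ℝ → ℝ} (hG : G 0 = 0) : ∑ j, G (spikes a p j) = k * G a := by
  have h1 : ∀ i, spikes a p (p i) = a := by
    intro i
    simp [spikes, hp.eq_iff]
  have h2 : ∀ j, j ∉ Finset.univ.image p → G (spikes a p j) = 0 := by
    intro j hj
    have : spikes a p j = 0 := by
      refine Finset.sum_eq_zero fun i _ => if_neg fun h => hj ?_
      simp only [Finset.mem_image, Finset.mem_univ, true_and]
      exact ⟨i, h⟩
    rw [this, hG]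
  rw [← Finset.sum_subset (Finset.subset_univ (Finset.univ.image p)) fun j _ hj => h2 j hj,
    Finset.sum_image fun x _ y _ h => hp h]
  simp [h1]

lemma sum_spikes_mul_spikes {d k : ℕ} (a : ℝ) (p p' : Fin k → Fin d) :
    ∑ j, spikes a p j * spikes a p' j = ∑ i, ∑ i', if p i = p' i' then a ^ 2 else 0 := by
  simp only [spikes, Finset.sum_mul_sum]
  rw [Finset.sum_comm]
  refine Finset.sum_congr rfl fun i _ => ?_
  rw [Finset.sum_comm]
  refine Finset.sum_congr rfl fun i' _ => ?_
  simp only [ite_mul, zero_mul, Finset.sum_ite_eq, Finset.mem_univ, if_true, mul_ite, mul_zero]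
  simp only [sq]

/-- The second moment of the likelihood ratio for the prior that puts one spike uniformly at random
in each of `k` blocks of size `n`. -/
lemma sum_exp_spikes {d k n : ℕ} (a : ℝ) (e : Fin k × Fin n ↪ Fin d) :
    ∑ ω : Fin k → Fin n, ∑ ω' : Fin k → Fin n,
        Real.exp (∑ j, spikes a (fun i => e (i, ω i)) j * spikes a (fun i => e (i, ω' i)) j)
      = (n : ℝ) ^ k * (n + (Real.exp (a ^ 2) - 1)) ^ k := by
  have h1 : ∀ ω : Fin k → Fin n, ∑ ω' : Fin k → Fin n,
      Real.exp (∑ j, spikes a (fun i => e (i, ω i)) j * spikes a (fun i => e (i, ω' i)) j)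
        = (n + (Real.exp (a ^ 2) - 1)) ^ k := by
    intro ω
    have h2 : ∀ ω' : Fin k → Fin n,
        Real.exp (∑ j, spikes a (fun i => e (i, ω i)) j * spikes a (fun i => e (i, ω' i)) j)
        = ∏ i, if ω i = ω' i then Real.exp (a ^ 2) else 1 := by
      intro ω'
      rw [sum_spikes_mul_spikes, Real.exp_sum]
      refine Finset.prod_congr rfl fun i _ => ?_
      -- Blocks are disjoint, so spikes of different blocks never meet and only the diagonal terms
      -- survive.
      rw [Finset.sum_eq_single i]
      · by_cases h : ω i = ω' i <;> simp [h]
      · intro b _ hb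
        simp [hb.symm]
      · simp
    simp_rw [h2]
    rw [← Fintype.prod_sum fun i (x : Fin n) => if ω i = x then Real.exp (a ^ 2) else 1]
    have h3 : ∀ i, ∑ x : Fin n, (if ω i = x then Real.exp (a ^ 2) else 1)
        = n + (Real.exp (a ^ 2) - 1) := by
      intro i
      have : ∀ x : Fin n, (if ω i = x then Real.exp (a ^ 2) else 1)
          = 1 + if ω i = x then Real.exp (a ^ 2) - 1 else 0 := by
        intro x; split_ifs <;> ring
      simp_rw [this, Finset.sum_add_distrib]
      simp
    simp_rw [h3]
    simp
  simp_rw [h1]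
  simp

/-- By concavity, `exp (a²) ≤ (1 + d/k²) ^ (1/4) ≤ 1 + d / (4k²)`. Since `d ≤ 2 k n` for `n = ⌊d /
k⌋`, each factor is at most `n (1 + 1 / (2k))`, and `(1 + 1 / (2k)) ^ k ≤ exp (1/2) < 2`. -/
lemma second_moment_le {d k : ℕ} (hk : 1 ≤ k) (hkd : k ^ 2 ≤ d) {a : ℝ}
    (ha : a ^ 2 ≤ Real.log (1 + d / (k : ℝ) ^ 2) / 4) :
    ((d / k : ℕ) + (Real.exp (a ^ 2) - 1)) ^ k ≤ 2 * ((d / k : ℕ) : ℝ) ^ k := by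
  set n := d / k with hn
  have hk0 : (0 : ℝ) < k := by exact_mod_cast hk
  have hkn : k ≤ n := by
    rw [hn, Nat.le_div_iff_mul_le (by omega)]; nlinarith
  have hn0 : (0 : ℝ) < n := by
    have : 1 ≤ n := hk.trans hkn
    exact_mod_cast this
  have hdn : (d : ℝ) ≤ 2 * k * n := by
    have h := Nat.div_add_mod d k
    have h' := Nat.mod_lt d (show k > 0 by omega)
    have : d ≤ 2 * k * n := by rw [← hn] at h; nlinarith
    exact_mod_cast this
  have hx : (0 : ℝ) ≤ d / (k : ℝ) ^ 2 := by positivity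
  have h1 : Real.exp (a ^ 2) - 1 ≤ 1 / 4 * (d / (k : ℝ) ^ 2) := by
    have h2 : Real.exp (a ^ 2) ≤ (1 + d / (k : ℝ) ^ 2) ^ (1 / 4 : ℝ) := by
      rw [Real.rpow_def_of_pos (by linarith)]
      exact Real.exp_le_exp.2 (by linarith)
    have h3 := rpow_one_add_le_one_add_mul_self (s := d / (k : ℝ) ^ 2) (by linarith)
      (p := 1 / 4) (by norm_num) (by norm_num)
    linarith
  have h4 : Real.exp (a ^ 2) - 1 ≤ n * (1 / (2 * k)) := by
    refine h1.trans ?_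
    rw [mul_one_div, one_div_mul_eq_div, div_div, div_le_div_iff₀ (by positivity) (by positivity)]
    nlinarith [mul_le_mul_of_nonneg_left hdn hk0.le]
  have h5 : (n : ℝ) + (Real.exp (a ^ 2) - 1) ≤ n * Real.exp (1 / (2 * k)) := by
    have := Real.add_one_le_exp (1 / (2 * k : ℝ))
    nlinarith
  have h6 : 0 ≤ Real.exp (a ^ 2) - 1 := by
    have := Real.add_one_le_exp (a ^ 2); nlinarith [sq_nonneg a]
  calc ((n : ℝ) + (Real.exp (a ^ 2) - 1)) ^ k ≤ (n * Real.exp (1 / (2 * k))) ^ k := by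
        gcongr
    _ = Real.exp (1 / 2) * (n : ℝ) ^ k := by
        rw [mul_pow, ← Real.exp_nat_mul, mul_comm]
        congr 2
        field_simp
    _ ≤ 2 * (n : ℝ) ^ k := by
        gcongr
        have h7 : Real.exp (1 / 2) ^ 2 < 2 ^ 2 := by
          rw [← Real.exp_nat_mul]
          have := Real.exp_one_lt_d9
          norm_num at *; linarith
        exact (lt_of_pow_lt_pow_left₀ 2 (by norm_num) h7).le

/-- Spikes of height `σ a` at `k ≤ √d` positions give a lower bound for the minimax risk. -/
lemma le_minimaxRisk {d k : ℕ} {q r σ a : ℝ} (hq : 0 < q) (hσ : 0 < σ) (hr : 0 < r)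
    (hk : 1 ≤ k) (hkd : k ^ 2 ≤ d) (ha0 : 0 ≤ a)
    (ha : a ^ 2 ≤ Real.log (1 + d / (k : ℝ) ^ 2) / 4)
    (har : σ ^ 2 * a ^ 2 ≤ r ^ 2 * (k : ℝ) ^ (-2 / q)) :
    ENNReal.ofReal (σ ^ 2 * k * a ^ 2 / 6) ≤ minimaxRisk σ l2Norm (lqBall d q r) := by
  have hk0 : (0 : ℝ) < k := by exact_mod_cast hk
  set n := d / k with hn
  have hkn : k ≤ n := by
    rw [hn, Nat.le_div_iff_mul_le (by omega)]; nlinarith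
  have : NeZero n := ⟨by omega⟩
  obtain ⟨e⟩ : Nonempty (Fin k × Fin n ↪ Fin d) := by
    apply Function.Embedding.nonempty_of_card_le
    simp only [Fintype.card_prod, Fintype.card_fin]
    exact Nat.mul_div_le d k
  have hinj : ∀ ω : Fin k → Fin n, Function.Injective fun i => e (i, ω i) := by
    intro ω i i' h
    exact (Prod.mk.inj (e.injective h)).1
  have hmem0 : (fun j : Fin d => σ * (0 : Fin d → ℝ) j) ∈ lqBall d q r := by
    simp [lqBall, lqNorm, Real.zero_rpow hq.ne', Real.zero_rpow (inv_pos.2 hq).ne', hr.le]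
  have hmem : ∀ ω : Fin k → Fin n,
      (fun j => σ * spikes a (fun i => e (i, ω i)) j) ∈ lqBall d q r := by
    intro ω
    simp only [lqBall, lqNorm, Set.mem_ofPred_eq]
    rw [sum_comp_spikes (hinj ω) (G := fun x => |σ * x| ^ q) (by simp [Real.zero_rpow hq.ne']),
      abs_of_nonneg (by positivity), Real.mul_rpow hk0.le (by positivity),
      ← Real.rpow_mul (by positivity), mul_one_div_cancel hq.ne', Real.rpow_one]
    refine le_of_sq_le_sq ?_ hr.le
    rw [mul_pow, ← Real.rpow_natCast ((k : ℝ) ^ (1 / q)), ← Real.rpow_mul hk0.le]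
    have h2 : (1 / q * ((2 : ℕ) : ℝ)) = -(-2 / q) := by push_cast; ring
    rw [h2, Real.rpow_neg hk0.le, inv_mul_le_iff₀ (Real.rpow_pos_of_pos hk0 _), mul_pow]
    linarith
  unfold minimaxRisk
  refine le_iInf₂ fun That hT => ?_
  have hrisk : ∀ t : Fin d → ℝ, (fun j => σ * t j) ∈ lqBall d q r →
      ∫⁻ x, ENNReal.ofReal ((That (fun j => σ * x j) - l2Norm (fun j => σ * t j)) ^ 2)
          ∂(shiftLaw t) ≤ maxRisk σ l2Norm (lqBall d q r) That := by
    intro t ht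
    rw [← sqRisk_mul _ _ _ hT]
    exact le_iSup₂ (f := fun θ _ => sqRisk σ l2Norm That θ) _ ht
  have key := le_of_mixture (d := d) (fun ω : Fin k → Fin n => spikes a fun i => e (i, ω i))
    (S := fun x => That fun j => σ * x j) (by fun_prop) (ρ := √(k * (σ * a) ^ 2))
    (R := maxRisk σ l2Norm (lqBall d q r) That) ?_ ?_ ?_
  · rw [Real.sq_sqrt (by positivity)] at key
    rwa [show σ ^ 2 * k * a ^ 2 / 6 = k * (σ * a) ^ 2 / 6 by ring]
  · have := hrisk 0 hmem0
    simpa [l2Norm] using this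
  · intro ω
    have := hrisk _ (hmem ω)
    rwa [l2Norm, sum_comp_spikes (hinj ω) (G := fun x => (σ * x) ^ 2) (by simp)] at this
  · rw [sum_exp_spikes]
    have := second_moment_le hk hkd ha
    rw [← hn] at this
    simp only [Fintype.card_fun, Fintype.card_fin]
    push_cast
    have h3 : (0 : ℝ) ≤ (n : ℝ) ^ k := by positivity
    nlinarith

/-! ### Moments and changes of measure for one Gaussian variable -/

lemma integrable_of_le_quartic {t C : ℝ} {g : ℝ → ℝ} (hg : Measurable g)
    (h : ∀ x, |g x| ≤ C * (1 + x ^ 4)) : Integrable g (gaussianReal t 1) := by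
  have h4 : Integrable (fun x : ℝ => x ^ 4) (gaussianReal t 1) := by
    refine ((memLp_id_gaussianReal (μ := t) (v := 1) 4).integrable_norm_pow (p := 4)
      (by norm_num)).congr (ae_of_all _ fun x => ?_)
    simp only [id, Real.norm_eq_abs]
    exact Even.pow_abs (by decide) x
  exact (((integrable_const 1).add h4).const_mul C).mono' hg.aestronglyMeasurable
    (ae_of_all _ fun x => h x)

lemma memLp_two_of_le_quadratic {t C : ℝ} {g : ℝ → ℝ} (hg : Measurable g)
    (h : ∀ x, |g x| ≤ C * (1 + x ^ 2)) : MemLp g 2 (gaussianReal t 1) := by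
  rw [memLp_two_iff_integrable_sq hg.aestronglyMeasurable]
  refine integrable_of_le_quartic (C := 2 * C ^ 2) (hg.pow_const 2) fun x => ?_
  rw [abs_of_nonneg (sq_nonneg _), ← sq_abs]
  calc |g x| ^ 2 ≤ (C * (1 + x ^ 2)) ^ 2 := by gcongr; exact h x
    _ ≤ 2 * C ^ 2 * (1 + x ^ 4) := by nlinarith [mul_nonneg (sq_nonneg C) (sq_nonneg (1 - x ^ 2))]

lemma integral_gaussianReal_eq_shift (t : ℝ) (f : ℝ → ℝ) :
    ∫ x, f x ∂(gaussianReal t 1) = ∫ x, f (x + t) ∂(gaussianReal 0 1) := by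
  have h : gaussianReal t 1 = (gaussianReal 0 1).map (· + t) := by
    rw [gaussianReal_map_add_const, zero_add]
  rw [h]
  exact (MeasurableEquiv.addRight t).measurableEmbedding.integral_map f

lemma integral_gaussianReal_eq_exp (t : ℝ) (f : ℝ → ℝ) :
    ∫ x, f x ∂(gaussianReal t 1)
      = ∫ x, Real.exp (t * x - t ^ 2 / 2) * f x ∂(gaussianReal 0 1) := by
  rw [gaussianReal_eq_withDensity, integral_withDensity_eq_integral_toReal_smul (by fun_prop)
    (ae_of_all _ fun _ => ENNReal.ofReal_lt_top)]
  simp [ENNReal.toReal_ofReal (Real.exp_pos _).le]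

lemma integrable_gaussianReal_iff_exp (t : ℝ) (f : ℝ → ℝ) :
    Integrable f (gaussianReal t 1) ↔
      Integrable (fun x => Real.exp (t * x - t ^ 2 / 2) * f x) (gaussianReal 0 1) := by
  rw [gaussianReal_eq_withDensity, integrable_withDensity_iff_integrable_smul' (by fun_prop)
    (ae_of_all _ fun _ => ENNReal.ofReal_lt_top)]
  simp [ENNReal.toReal_ofReal (Real.exp_pos _).le]

lemma integral_sq_gaussianReal : ∫ x, x ^ 2 ∂(gaussianReal 0 1) = 1 := by
  have h := variance_fun_id_gaussianReal (μ := 0) (v := 1)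
  rw [variance_eq_integral aemeasurable_id'] at h
  simpa using h

lemma integral_exp_mul_gaussianReal (t s : ℝ) :
    ∫ x, Real.exp (s * x) ∂(gaussianReal t 1) = Real.exp (t * s + s ^ 2 / 2) := by
  have h := congrFun (mgf_fun_id_gaussianReal (μ := t) (v := 1)) s
  simpa [mgf] using h

/-- The bound `(2y)⁴ / 4! ≤ exp (2y)` reduces the fourth moment to two values of the moment
generating function. -/
lemma pow_four_le_exp (x : ℝ) : x ^ 4 ≤ 12 * (Real.exp (2 * x) + Real.exp (-2 * x)) / 8 := by
  have h : ∀ y : ℝ, 0 ≤ y → y ^ 4 ≤ 12 * (Real.exp (2 * y) + Real.exp (-2 * y)) / 8 := by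
    intro y hy
    have h1 := Real.pow_div_factorial_le_exp (2 * y) (by positivity) 4
    have h2 := Real.exp_pos (-2 * y)
    norm_num [Nat.factorial] at h1
    nlinarith
  rcases le_total 0 x with hx | hx
  · exact h x hx
  · have := h (-x) (by linarith)
    rw [show 2 * -x = -2 * x by ring, show -2 * -x = 2 * x by ring] at this
    nlinarith

lemma integral_pow_four_gaussianReal_le : ∫ x, x ^ 4 ∂(gaussianReal 0 1) ≤ 48 := by
  have hi : ∀ s : ℝ, Integrable (fun x => Real.exp (s * x)) (gaussianReal 0 1) := fun s =>
    integrable_exp_mul_gaussianReal s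
  calc ∫ x, x ^ 4 ∂(gaussianReal 0 1)
      ≤ ∫ x, 12 * (Real.exp (2 * x) + Real.exp (-2 * x)) / 8 ∂(gaussianReal 0 1) := by
        refine integral_mono (integrable_of_le_quartic (C := 1) (by fun_prop) fun x => ?_)
          ((((hi 2).add (hi (-2))).const_mul 12).div_const 8) pow_four_le_exp
        rw [abs_of_nonneg (by positivity)]; linarith
    _ = 3 * Real.exp 2 := by
        rw [integral_div, integral_const_mul, integral_add (hi 2) (hi (-2)),
          integral_exp_mul_gaussianReal, integral_exp_mul_gaussianReal]
        norm_num; ring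
    _ ≤ 48 := by
        have h : Real.exp 2 = Real.exp 1 ^ 2 := by rw [← Real.exp_nat_mul]; norm_num
        have := Real.exp_one_lt_d9
        have := Real.exp_pos 1
        rw [h]; nlinarith

lemma integral_sq_gaussianReal_shift (t : ℝ) : ∫ x, x ^ 2 ∂(gaussianReal t 1) = t ^ 2 + 1 := by
  rw [integral_gaussianReal_eq_shift]
  have h1 : Integrable (fun x : ℝ => x ^ 2) (gaussianReal 0 1) :=
    integrable_of_le_quartic (C := 1) (by fun_prop) fun x => by
      rw [abs_of_nonneg (by positivity)]; nlinarith [sq_nonneg (x ^ 2 - 1)]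
  have h2 : Integrable (fun x : ℝ => 2 * t * x) (gaussianReal 0 1) :=
    (memLp_id_gaussianReal 1).integrable (by simp) |>.const_mul (2 * t)
  have : ∀ x : ℝ, (x + t) ^ 2 = x ^ 2 + 2 * t * x + t ^ 2 := fun x => by ring
  simp_rw [this]
  rw [integral_add (by exact h1.add h2) (integrable_const _), integral_add h1 h2, integral_sq_gaussianReal,
    integral_const_mul, integral_id_gaussianReal]
  simp; ring

lemma integral_sq_sub_sq_le (t : ℝ) :
    ∫ x, (x ^ 2 - t ^ 2) ^ 2 ∂(gaussianReal t 1) ≤ 96 + 8 * t ^ 2 := by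
  rw [integral_gaussianReal_eq_shift]
  have h4 : Integrable (fun x : ℝ => x ^ 4) (gaussianReal 0 1) :=
    integrable_of_le_quartic (C := 1) (by fun_prop) fun x => by
      rw [abs_of_nonneg (by positivity)]; linarith
  have h2 : Integrable (fun x : ℝ => x ^ 2) (gaussianReal 0 1) :=
    integrable_of_le_quartic (C := 1) (by fun_prop) fun x => by
      rw [abs_of_nonneg (by positivity)]; nlinarith [sq_nonneg (x ^ 2 - 1)]
  calc ∫ x, ((x + t) ^ 2 - t ^ 2) ^ 2 ∂(gaussianReal 0 1)
      ≤ ∫ x, (2 * x ^ 4 + 8 * t ^ 2 * x ^ 2) ∂(gaussianReal 0 1) := by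
        refine integral_mono_of_nonneg (ae_of_all _ fun x => sq_nonneg _)
          ((h4.const_mul 2).add (h2.const_mul _)) (ae_of_all _ fun x => ?_)
        simp only
        nlinarith [sq_nonneg (x ^ 2 - 2 * t * x)]
    _ ≤ 96 + 8 * t ^ 2 := by
        rw [integral_add (h4.const_mul 2) (h2.const_mul _), integral_const_mul, integral_const_mul,
          integral_sq_gaussianReal]
        linarith [integral_pow_four_gaussianReal_le]

lemma variance_le_integral_sub_sq {t : ℝ} {h : ℝ → ℝ} (hm : Measurable h) (c : ℝ) :
    Var[h; gaussianReal t 1] ≤ ∫ x, (h x - c) ^ 2 ∂(gaussianReal t 1) := by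
  rw [← variance_sub_const hm.aestronglyMeasurable c]
  exact variance_le_expectation_sq (hm.sub_const c).aestronglyMeasurable

/-! ### The hard-threshold statistic and Gaussian tails -/

/-- `x² - α` above the threshold `τ` and `0` below. -/
noncomputable def hardStat (τ α x : ℝ) : ℝ := if τ < |x| then x ^ 2 - α else 0

/-- `x⁴` above the threshold `τ` and `0` below. -/
noncomputable def tailFourth (τ x : ℝ) : ℝ := if τ < |x| then x ^ 4 else 0

lemma measurableSet_lt_abs (τ : ℝ) : MeasurableSet {x : ℝ | τ < |x|} :=
  measurableSet_lt measurable_const measurable_abs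

lemma measurable_hardStat (τ α : ℝ) : Measurable (hardStat τ α) :=
  Measurable.ite (measurableSet_lt_abs τ) (by fun_prop) measurable_const

lemma measurable_tailFourth (τ : ℝ) : Measurable (tailFourth τ) :=
  Measurable.ite (measurableSet_lt_abs τ) (by fun_prop) measurable_const

lemma tailFourth_nonneg (τ x : ℝ) : 0 ≤ tailFourth τ x := by
  unfold tailFourth; split_ifs <;> positivity

lemma integrable_tailFourth (t τ : ℝ) : Integrable (tailFourth τ) (gaussianReal t 1) :=
  integrable_of_le_quartic (C := 1) (measurable_tailFourth τ) fun x => by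
    rw [abs_of_nonneg (tailFourth_nonneg _ _)]
    unfold tailFourth
    split_ifs
    · linarith
    · positivity

/-- The integrand is the derivative of `(τ² / y - y) exp (-y² / 2)`, which vanishes at `τ` and at
infinity. As `τ² / y² ≤ 1` beyond `τ`, it dominates `y² - (τ² + 2)` times the same exponential,
which yields the Mills bound. -/
lemma tail_exp_deriv_integral {τ : ℝ} (hτ : 0 < τ) :
    ∫ y in Set.Ioi τ, (y ^ 2 - 1 - τ ^ 2 - τ ^ 2 / y ^ 2) * Real.exp (-(1 / 2) * y ^ 2) = 0
    ∧ IntegrableOn (fun y => (y ^ 2 - 1 - τ ^ 2 - τ ^ 2 / y ^ 2) * Real.exp (-(1 / 2) * y ^ 2))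
      (Set.Ioi τ) := by
  have i0 : Integrable fun y : ℝ => Real.exp (-(1 / 2) * y ^ 2) :=
    integrable_exp_neg_mul_sq (by norm_num)
  have i1 : Integrable fun y : ℝ => y * Real.exp (-(1 / 2) * y ^ 2) :=
    integrable_mul_exp_neg_mul_sq (by norm_num)
  have i2 : Integrable fun y : ℝ => y ^ 2 * Real.exp (-(1 / 2) * y ^ 2) := by
    have := integrable_rpow_mul_exp_neg_mul_sq (b := 1 / 2) (by norm_num) (s := 2) (by norm_num)
    simpa using this
  have hdiv : ∀ y : ℝ, τ < y → τ ^ 2 / y ^ 2 ≤ 1 := by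
    intro y hy
    rw [div_le_one (by nlinarith)]
    gcongr
  have hi : IntegrableOn (fun y => (y ^ 2 - 1 - τ ^ 2 - τ ^ 2 / y ^ 2) *
      Real.exp (-(1 / 2) * y ^ 2)) (Set.Ioi τ) := by
    refine ((i2.add (i0.const_mul (τ ^ 2 + 2))).integrableOn (s := Set.Ioi τ)).mono'
      (by fun_prop) ?_
    refine (ae_restrict_iff' measurableSet_Ioi).2 (ae_of_all _ fun y hy => ?_)
    rw [Real.norm_eq_abs, abs_mul, abs_of_pos (Real.exp_pos _), Pi.add_apply, ← add_mul]
    gcongr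
    have h1 := hdiv y hy
    have h2 : 0 ≤ τ ^ 2 / y ^ 2 := by positivity
    rw [abs_le]; constructor <;> nlinarith [sq_nonneg y]
  refine ⟨?_, hi⟩
  have hderiv : ∀ x ∈ Set.Ici τ, HasDerivAt
      (fun y => (τ ^ 2 * y⁻¹ - y) * Real.exp (-(1 / 2) * y ^ 2))
      ((x ^ 2 - 1 - τ ^ 2 - τ ^ 2 / x ^ 2) * Real.exp (-(1 / 2) * x ^ 2)) x := by
    intro x hx
    have hx0 : x ≠ 0 := (hτ.trans_le hx).ne'
    have := (((hasDerivAt_inv hx0).const_mul (τ ^ 2)).sub (hasDerivAt_id x)).mul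
      ((((hasDerivAt_id x).pow 2).const_mul (-(1 / 2))).exp)
    refine this.congr_deriv ?_
    simp only [id, Pi.sub_apply, Pi.pow_apply]
    field_simp
    ring
  have hf : IntegrableOn (fun y => (τ ^ 2 * y⁻¹ - y) * Real.exp (-(1 / 2) * y ^ 2))
      (Set.Ioi τ) := by
    refine ((i1.add (i0.const_mul τ)).integrableOn (s := Set.Ioi τ)).mono' (by fun_prop) ?_
    refine (ae_restrict_iff' measurableSet_Ioi).2 (ae_of_all _ fun y hy => ?_)
    rw [Real.norm_eq_abs, abs_mul, abs_of_pos (Real.exp_pos _), Pi.add_apply, ← add_mul]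
    gcongr
    have hy' : τ < y := hy
    have hy0 : 0 < y := hτ.trans hy'
    have h1 : τ ^ 2 * y⁻¹ ≤ τ := by
      rw [← div_eq_mul_inv, div_le_iff₀ hy0]; nlinarith
    have h2 : 0 ≤ τ ^ 2 * y⁻¹ := by positivity
    rw [abs_le]; constructor <;> linarith
  have := integral_Ioi_of_hasDerivAt_of_tendsto' hderiv hi
    (tendsto_zero_of_hasDerivAt_of_integrableOn_Ioi (fun x hx => hderiv x (Set.Ioi_subset_Ici_self hx)) hi hf)
  rw [this]
  field_simp
  simp

/-- A Mills ratio bound: beyond `τ` the second moment of a standard normal variable is at most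
`(τ² + 2)` times its tail probability. -/
lemma integral_tail_sq_sub_nonpos {τ : ℝ} (hτ : 0 < τ) :
    ∫ x in {x : ℝ | τ < |x|}, (x ^ 2 - (τ ^ 2 + 2)) ∂(gaussianReal 0 1) ≤ 0 := by
  rw [← integral_indicator (measurableSet_lt_abs τ),
    integral_gaussianReal_eq_integral_smul one_ne_zero]
  set c : ℝ := (√(2 * Real.pi))⁻¹ with hc
  have hc0 : 0 ≤ c := by positivity
  set f : ℝ → ℝ := (Set.Ioi τ).indicator
    fun y => (y ^ 2 - (τ ^ 2 + 2)) * Real.exp (-(1 / 2) * y ^ 2) with hf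
  have h1 : ∀ x, gaussianPDFReal 0 1 x • {x : ℝ | τ < |x|}.indicator
      (fun x => x ^ 2 - (τ ^ 2 + 2)) x = c * f |x| := by
    intro x
    by_cases hx : τ < |x|
    · rw [hf, Set.indicator_of_mem (show x ∈ {x : ℝ | τ < |x|} from hx),
        Set.indicator_of_mem (show |x| ∈ Set.Ioi τ from hx), gaussianPDFReal, sq_abs]
      simp only [NNReal.coe_one, mul_one, sub_zero, smul_eq_mul, hc]
      rw [show -x ^ 2 / 2 = -(1 / 2) * x ^ 2 by ring]
      ring
    · rw [hf, Set.indicator_of_notMem (show x ∉ {x : ℝ | τ < |x|} from hx),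
        Set.indicator_of_notMem (show |x| ∉ Set.Ioi τ from hx)]
      simp
  simp_rw [h1]
  rw [integral_const_mul, integral_comp_abs, hf, setIntegral_indicator measurableSet_Ioi,
    Set.Ioi_inter_Ioi, sup_of_le_right hτ.le]
  have h2 := tail_exp_deriv_integral hτ
  have i0 : Integrable fun y : ℝ => Real.exp (-(1 / 2) * y ^ 2) :=
    integrable_exp_neg_mul_sq (by norm_num)
  have i2 : Integrable fun y : ℝ => y ^ 2 * Real.exp (-(1 / 2) * y ^ 2) := by
    have := integrable_rpow_mul_exp_neg_mul_sq (b := 1 / 2) (by norm_num) (s := 2) (by norm_num)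
    simpa using this
  have h3 : ∫ y in Set.Ioi τ, (y ^ 2 - (τ ^ 2 + 2)) * Real.exp (-(1 / 2) * y ^ 2) ≤ 0 := by
    rw [← h2.1]
    refine setIntegral_mono_on ?_ h2.2 measurableSet_Ioi fun y hy => ?_
    · simp_rw [sub_mul]
      exact (i2.sub (i0.const_mul _)).integrableOn
    · refine mul_le_mul_of_nonneg_right ?_ (Real.exp_pos _).le
      have hy' : τ < y := hy
      have : τ ^ 2 / y ^ 2 ≤ 1 := by
        rw [div_le_one (by nlinarith)]
        gcongr
      linarith
  nlinarith

lemma gaussianReal_tail_pos (τ : ℝ) : 0 < (gaussianReal 0 1).real {x : ℝ | τ < |x|} := by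
  have h := gaussianReal_absolutelyContinuous' 0 (v := 1) one_ne_zero
  refine ENNReal.toReal_pos (fun h0 => ?_) (measure_ne_top _ _)
  have h1 := h h0
  have h2 : Set.Ioi τ ⊆ {x : ℝ | τ < |x|} := fun x hx => lt_of_lt_of_le hx (le_abs_self x)
  have := measure_mono_null h2 h1
  simp at this

/-- The conditional second moment of a standard normal variable beyond `τ`. -/
noncomputable def tailMoment (τ : ℝ) : ℝ :=
  ∫ x, x ^ 2 ∂(ProbabilityTheory.cond (gaussianReal 0 1) {x : ℝ | τ < |x|})

lemma tailMoment_mul (τ : ℝ) :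
    tailMoment τ * (gaussianReal 0 1).real {x : ℝ | τ < |x|}
      = ∫ x in {x : ℝ | τ < |x|}, x ^ 2 ∂(gaussianReal 0 1) := by
  have h := gaussianReal_tail_pos τ
  rw [tailMoment, ProbabilityTheory.cond, integral_smul_measure, ENNReal.toReal_inv, smul_eq_mul]
  rw [← measureReal_def]
  field_simp

lemma integrable_sq_gaussianReal (t : ℝ) : Integrable (fun x : ℝ => x ^ 2) (gaussianReal t 1) :=
  integrable_of_le_quartic (C := 1) (by fun_prop) fun x => by
    rw [abs_of_nonneg (by positivity)]; nlinarith [sq_nonneg (x ^ 2 - 1)]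

lemma tailMoment_nonneg (τ : ℝ) : 0 ≤ tailMoment τ := integral_nonneg fun x => sq_nonneg x

lemma tailMoment_le {τ : ℝ} (hτ : 0 < τ) : tailMoment τ ≤ τ ^ 2 + 2 := by
  have h := integral_tail_sq_sub_nonpos hτ
  rw [integral_sub (integrable_sq_gaussianReal 0).integrableOn (integrable_const _),
    ← tailMoment_mul] at h
  simp only [integral_const, smul_eq_mul, measureReal_restrict_apply_univ] at h
  have hp := gaussianReal_tail_pos τ
  nlinarith

/-- This is the purpose of centring at the conditional second moment: null coordinates contribute no
bias. -/
lemma integral_hardStat_zero (τ : ℝ) :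
    ∫ x, hardStat τ (tailMoment τ) x ∂(gaussianReal 0 1) = 0 := by
  have h1 : hardStat τ (tailMoment τ)
      = {x : ℝ | τ < |x|}.indicator fun x => x ^ 2 - tailMoment τ := by
    ext x; simp [hardStat, Set.indicator]
  rw [h1, integral_indicator (measurableSet_lt_abs τ),
    integral_sub (integrable_sq_gaussianReal 0).integrableOn (integrable_const _),
    ← tailMoment_mul]
  simp [mul_comm]

section
variable {τ α : ℝ} (hτ : 4 ≤ τ ^ 2) (hτ0 : 0 ≤ τ) (hα0 : 0 ≤ α) (hα : α ≤ τ ^ 2 + 2)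
include hτ hτ0 hα0 hα

lemma abs_hardStat_le (x : ℝ) : |hardStat τ α x| ≤ 2 * x ^ 2 := by
  unfold hardStat
  split_ifs with h
  · have h1 : τ ^ 2 ≤ x ^ 2 := by rw [← sq_abs x]; gcongr
    rw [abs_le]; constructor <;> linarith
  · rw [abs_zero]; positivity

/-- The weight `x² + 1` is what the second-order bound on the symmetrised likelihood ratio produces.
-/
lemma abs_hardStat_mul_le (x : ℝ) : |hardStat τ α x| * (x ^ 2 + 1) ≤ 4 * tailFourth τ x := by
  have h0 := abs_hardStat_le hτ hτ0 hα0 hα x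
  unfold tailFourth
  unfold hardStat at *
  split_ifs at * with h
  · have h1 : τ ^ 2 ≤ x ^ 2 := by rw [← sq_abs x]; gcongr
    nlinarith
  · simp

lemma hardStat_sq_le (x : ℝ) : hardStat τ α x ^ 2 ≤ 4 * tailFourth τ x := by
  have h0 := abs_hardStat_le hτ hτ0 hα0 hα x
  rw [← sq_abs]
  unfold tailFourth
  unfold hardStat at *
  split_ifs at * with h
  · nlinarith [abs_nonneg (x ^ 2 - α)]
  · simp

end

lemma abs_hardStat_sub_sq_le {τ α : ℝ} (hτ : 4 ≤ τ ^ 2) (hα0 : 0 ≤ α)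
    (hα : α ≤ τ ^ 2 + 2) (x : ℝ) : |hardStat τ α x - x ^ 2| ≤ 2 * τ ^ 2 := by
  unfold hardStat
  split_ifs with h
  · rw [abs_le]; constructor <;> linarith
  · have h1 : x ^ 2 ≤ τ ^ 2 := by rw [← sq_abs x]; gcongr; exact not_lt.1 h
    rw [abs_le]; constructor <;> nlinarith [sq_nonneg x]

/-- A Chernoff bound with the polynomial absorbed: `u ≤ exp (u - 1)` at `u = |x| / (2τ)`, where `1 ≤
s τ` bounds the exponent by `s (|x| - τ) / 2`. The fourth power has rate `2 s`. -/
lemma tailFourth_le_exp {s τ : ℝ} (hτ : 0 < τ) (hsτ : 1 ≤ s * τ) (x : ℝ) :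
    tailFourth τ x ≤ 16 * τ ^ 4 * Real.exp (-2 * s * τ)
      * (Real.exp (2 * s * x) + Real.exp (-2 * s * x)) := by
  unfold tailFourth
  split_ifs with h
  · have h1 : |x| ≤ 2 * τ * Real.exp (|x| / (2 * τ) - 1) := by
      have := Real.add_one_le_exp (|x| / (2 * τ) - 1)
      rw [sub_add_cancel, div_le_iff₀ (by positivity)] at this
      linarith
    have h2 : |x| / (2 * τ) - 1 ≤ (s * |x| - s * τ) / 2 := by
      have : |x| / (2 * τ) - 1 / 2 ≤ (s * |x| - s * τ) / 2 := by
        have e : |x| / (2 * τ) - 1 / 2 = (|x| - τ) / (2 * τ) := by field_simp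
        rw [e, div_le_iff₀ (by positivity)]
        nlinarith
      linarith
    have h3 : Real.exp (2 * s * |x|) ≤ Real.exp (2 * s * x) + Real.exp (-2 * s * x) := by
      rcases abs_cases x with ⟨hx, _⟩ | ⟨hx, _⟩ <;> rw [hx]
      · linarith [Real.exp_pos (-2 * s * x)]
      · rw [show 2 * s * -x = -2 * s * x by ring]; linarith [Real.exp_pos (2 * s * x)]
    calc x ^ 4 = |x| ^ 4 := (Even.pow_abs (by decide) x).symm
      _ ≤ (2 * τ * Real.exp ((s * |x| - s * τ) / 2)) ^ 4 := by
          gcongr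
          exact h1.trans (by gcongr)
      _ = 16 * τ ^ 4 * Real.exp (-2 * s * τ) * Real.exp (2 * s * |x|) := by
          rw [mul_pow, ← Real.exp_nat_mul, mul_assoc (16 * τ ^ 4), ← Real.exp_add, mul_pow]
          congr 1
          · norm_num
          · congr 1; push_cast; ring
      _ ≤ _ := by gcongr
  · positivity

/-- Take `s = √L`. The threshold gains `exp (-2 s τ) ≤ exp (-5 L)`, while the moment generating
function at `±2s` costs at most `exp (4 L)` for `|t| ≤ s`. The factor `8` in the threshold leaves
the net `exp (-L)`. -/
lemma integral_tailFourth_le {L t : ℝ} (hL : 1 / 2 ≤ L) (ht : t ^ 2 ≤ L) :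
    ∫ x, tailFourth (√(8 * L)) x ∂(gaussianReal t 1) ≤ 2048 * L ^ 2 * Real.exp (-L) := by
  set s := √L with hs
  set τ := √(8 * L) with hτ
  have hs2 : s ^ 2 = L := Real.sq_sqrt (by linarith)
  have hτ2 : τ ^ 2 = 8 * L := Real.sq_sqrt (by linarith)
  have hs0 : 0 < s := Real.sqrt_pos.2 (by linarith)
  have hτ0 : 0 < τ := Real.sqrt_pos.2 (by linarith)
  have hsτ : 5 / 2 * s ≤ τ := by
    apply Real.le_sqrt_of_sq_le; nlinarith
  have hts : |t| ≤ s := Real.abs_le_sqrt ht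
  have hi : ∀ c : ℝ, Integrable (fun x => Real.exp (c * x)) (gaussianReal t 1) := fun c =>
    integrable_exp_mul_gaussianReal c
  have hb : ∀ c : ℝ, |c| ≤ 2 * s → Real.exp (t * c + c ^ 2 / 2) ≤ Real.exp (4 * L) := by
    intro c hc
    apply Real.exp_le_exp.2
    have h1 : t * c ≤ s * (2 * s) := by
      calc t * c ≤ |t| * |c| := by rw [← abs_mul]; exact le_abs_self _
        _ ≤ s * (2 * s) := by gcongr
    have h2 : c ^ 2 ≤ (2 * s) ^ 2 := by rw [← sq_abs]; gcongr
    nlinarith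
  calc ∫ x, tailFourth τ x ∂(gaussianReal t 1)
      ≤ ∫ x, 16 * τ ^ 4 * Real.exp (-2 * s * τ)
          * (Real.exp (2 * s * x) + Real.exp (-2 * s * x)) ∂(gaussianReal t 1) :=
        integral_mono (integrable_tailFourth t τ) (((hi _).add (hi _)).const_mul _)
          (tailFourth_le_exp hτ0 (by nlinarith))
    _ = 16 * τ ^ 4 * Real.exp (-2 * s * τ)
          * (Real.exp (t * (2 * s) + (2 * s) ^ 2 / 2)
            + Real.exp (t * (-2 * s) + (-2 * s) ^ 2 / 2)) := by
        rw [integral_const_mul, integral_add (hi _) (hi _), integral_exp_mul_gaussianReal,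
          integral_exp_mul_gaussianReal]
    _ ≤ 16 * τ ^ 4 * Real.exp (-(5 * L)) * (Real.exp (4 * L) + Real.exp (4 * L)) := by
        have h1 := hb (2 * s) (by rw [abs_of_pos (by positivity)])
        have h2 := hb (-2 * s) (by rw [neg_mul, abs_neg, abs_of_pos (by positivity)])
        have h3 : -2 * s * τ ≤ -(5 * L) := by nlinarith
        have h4 := Real.exp_le_exp.2 h3
        exact mul_le_mul (mul_le_mul_of_nonneg_left h4 (by positivity)) (add_le_add h1 h2)
          (by positivity) (by positivity)
    _ = 2048 * L ^ 2 * Real.exp (-L) := by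
        rw [show τ ^ 4 = (τ ^ 2) ^ 2 by ring, hτ2, ← two_mul, show -L = -(5 * L) + 4 * L by ring,
          Real.exp_add]
        ring

lemma integral_tailFourth_le_const {L t : ℝ} (hL : 1 / 2 ≤ L) (ht : t ^ 2 ≤ L) :
    ∫ x, tailFourth (√(8 * L)) x ∂(gaussianReal t 1) ≤ 4096 := by
  refine (integral_tailFourth_le hL ht).trans ?_
  have h := Real.quadratic_le_exp_of_nonneg (show 0 ≤ L by linarith)
  rw [Real.exp_neg, ← div_eq_mul_inv, div_le_iff₀ (Real.exp_pos L)]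
  nlinarith

/-! ### Bias and variance of one thresholded coordinate -/

/-- For `y ≥ 0` the left side equals `exp y * (1 - exp (-y))²`, and `1 - exp (-y) ≤ y`. -/
lemma exp_add_exp_neg_sub_two_le (z : ℝ) :
    Real.exp z + Real.exp (-z) - 2 ≤ z ^ 2 * (Real.exp z + Real.exp (-z)) := by
  have h : ∀ y : ℝ, 0 ≤ y →
      Real.exp y + Real.exp (-y) - 2 ≤ y ^ 2 * (Real.exp y + Real.exp (-y)) := by
    intro y hy
    have h1 := Real.add_one_le_exp (-y)
    have h2 : Real.exp (-y) ≤ 1 := Real.exp_le_one_iff.2 (by linarith)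
    have h3 : Real.exp y * Real.exp (-y) = 1 := by rw [← Real.exp_add]; simp
    have h4 := Real.exp_pos y
    have h5 : Real.exp y + Real.exp (-y) - 2 = Real.exp y * (1 - Real.exp (-y)) ^ 2 := by
      linear_combination (2 - Real.exp (-y)) * h3
    have h6 : (1 - Real.exp (-y)) ^ 2 ≤ y ^ 2 :=
      pow_le_pow_left₀ (by linarith) (by linarith) 2
    rw [h5]
    have := mul_nonneg (sq_nonneg y) (Real.exp_pos (-y)).le
    nlinarith
  rcases le_total 0 z with hz | hz
  · exact h z hz
  · have := h (-z) (by linarith)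
    rw [neg_neg] at this
    nlinarith

/-- Adding the likelihood ratios of `t` and `-t` cancels the first-order term, so the deviation from
`2` is quadratic in `t`. The last `t²` pays for the factor `exp (-t² / 2)`. -/
lemma abs_sum_shift_exp_le (t x : ℝ) :
    |Real.exp (t * x - t ^ 2 / 2) + Real.exp (-t * x - (-t) ^ 2 / 2) - 2|
      ≤ t ^ 2 * x ^ 2 * (Real.exp (t * x - t ^ 2 / 2) + Real.exp (-t * x - (-t) ^ 2 / 2))
        + t ^ 2 := by
  have e1 : Real.exp (t * x - t ^ 2 / 2) = Real.exp (-(t ^ 2 / 2)) * Real.exp (t * x) := by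
    rw [← Real.exp_add]; ring_nf
  have e2 : Real.exp (-t * x - (-t) ^ 2 / 2) = Real.exp (-(t ^ 2 / 2)) * Real.exp (-(t * x)) := by
    rw [← Real.exp_add]; ring_nf
  rw [e1, e2, ← mul_add]
  have h := exp_add_exp_neg_sub_two_le (t * x)
  have ha := Real.add_one_le_exp (-(t ^ 2 / 2))
  have ha1 : Real.exp (-(t ^ 2 / 2)) ≤ 1 := Real.exp_le_one_iff.2 (by nlinarith [sq_nonneg t])
  have ha0 := Real.exp_pos (-(t ^ 2 / 2))
  have h3 : Real.exp (t * x) * Real.exp (-(t * x)) = 1 := by rw [← Real.exp_add]; simp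
  have hS : 0 ≤ Real.exp (t * x) + Real.exp (-(t * x)) - 2 := by
    nlinarith [sq_nonneg (Real.exp (t * x) - Real.exp (-(t * x))), Real.exp_pos (t * x),
      Real.exp_pos (-(t * x))]
  set S := Real.exp (t * x) + Real.exp (-(t * x))
  set a := Real.exp (-(t ^ 2 / 2))
  have h5 : a * (S - 2) ≤ a * ((t * x) ^ 2 * S) := mul_le_mul_of_nonneg_left h ha0.le
  have h6 : 0 ≤ a * (S - 2) := mul_nonneg ha0.le hS
  have h7 : 0 ≤ a * ((t * x) ^ 2 * S) := h6.trans h5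
  rw [abs_le]
  constructor <;> nlinarith

lemma integral_even_neg {f : ℝ → ℝ} (hf : ∀ x, f (-x) = f x) (t : ℝ) :
    ∫ x, f x ∂(gaussianReal (-t) 1) = ∫ x, f x ∂(gaussianReal t 1) := by
  have h : gaussianReal (-t) 1 = (gaussianReal t 1).map fun x => -x :=
    gaussianReal_map_neg.symm
  rw [h]
  exact ((MeasurableEquiv.neg ℝ).measurableEmbedding.integral_map f).trans
    (integral_congr_ae (ae_of_all _ hf))

/-- The tuning of the hard-threshold statistic: threshold `√(8 L)`, centring at the conditional
second moment. -/
noncomputable def tunedStat (L : ℝ) : ℝ → ℝ := hardStat (√(8 * L)) (tailMoment (√(8 * L)))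

lemma measurable_tunedStat (L : ℝ) : Measurable (tunedStat L) := measurable_hardStat _ _

section
variable {L : ℝ} (hL : 1 / 2 ≤ L)
include hL

lemma four_le_threshold_sq : 4 ≤ √(8 * L) ^ 2 := by
  rw [Real.sq_sqrt (by linarith)]; linarith

lemma threshold_pos : 0 < √(8 * L) := Real.sqrt_pos.2 (by linarith)

lemma abs_tunedStat_le (x : ℝ) : |tunedStat L x| ≤ 2 * (1 + x ^ 2) :=
  (abs_hardStat_le (four_le_threshold_sq hL) (Real.sqrt_nonneg _) (tailMoment_nonneg _)
    (tailMoment_le (threshold_pos hL)) x).trans (by linarith)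

lemma memLp_tunedStat (t : ℝ) : MemLp (tunedStat L) 2 (gaussianReal t 1) :=
  memLp_two_of_le_quadratic (measurable_tunedStat L) (abs_tunedStat_le hL)

lemma integrable_tunedStat (t : ℝ) : Integrable (tunedStat L) (gaussianReal t 1) :=
  (memLp_tunedStat hL t).integrable (by norm_num)

/-- The statistic is even and has mean zero at `t = 0`, so twice its mean at `t` is its integral
against the symmetrised likelihood ratio minus `2`. This is at most `4 t²` times three tail moments,
each at most `4096`. -/
lemma abs_integral_tunedStat_le {t : ℝ} (ht : t ^ 2 ≤ L) :
    |∫ x, tunedStat L x ∂(gaussianReal t 1)| ≤ 24576 * t ^ 2 := by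
  set w : ℝ → ℝ → ℝ := fun t x => Real.exp (t * x - t ^ 2 / 2) with hw
  set τ := √(8 * L) with hτ
  have hev : ∀ x, tunedStat L (-x) = tunedStat L x := by intro x; simp [tunedStat, hardStat]
  have hG : ∀ t, Integrable (fun x => w t x * tunedStat L x) (gaussianReal 0 1) := fun t =>
    (integrable_gaussianReal_iff_exp t _).1 (integrable_tunedStat hL t)
  have hK : ∀ t, Integrable (fun x => w t x * tailFourth τ x) (gaussianReal 0 1) := fun t =>
    (integrable_gaussianReal_iff_exp t _).1 (integrable_tailFourth t τ)
  have e1 : 2 * ∫ x, tunedStat L x ∂(gaussianReal t 1)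
      = ∫ x, (w t x * tunedStat L x + w (-t) x * tunedStat L x - 2 * tunedStat L x)
          ∂(gaussianReal 0 1) := by
    rw [integral_sub (by exact (hG t).add (hG (-t))) ((integrable_tunedStat hL 0).const_mul 2),
      integral_add (hG t) (hG (-t)), integral_const_mul,
      show ∫ x, tunedStat L x ∂(gaussianReal 0 1) = 0 from integral_hardStat_zero _,
      ← integral_gaussianReal_eq_exp, ← integral_gaussianReal_eq_exp, integral_even_neg hev]
    ring
  have e2 : ∀ s, s ^ 2 ≤ L → ∫ x, w s x * tailFourth τ x ∂(gaussianReal 0 1) ≤ 4096 := by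
    intro s hs
    rw [← integral_gaussianReal_eq_exp]
    exact integral_tailFourth_le_const hL hs
  have e3 : ∫ x, tailFourth τ x ∂(gaussianReal 0 1) ≤ 4096 :=
    integral_tailFourth_le_const hL (by nlinarith)
  have e4 : |2 * ∫ x, tunedStat L x ∂(gaussianReal t 1)|
      ≤ ∫ x, 4 * t ^ 2 * (w t x * tailFourth τ x + w (-t) x * tailFourth τ x + tailFourth τ x)
          ∂(gaussianReal 0 1) := by
    rw [e1, ← Real.norm_eq_abs]
    refine norm_integral_le_of_norm_le
      ((((hK t).add (hK (-t))).add (integrable_tailFourth 0 τ)).const_mul _)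
      (ae_of_all _ fun x => ?_)
    have h1 := abs_hardStat_mul_le (four_le_threshold_sq hL) (Real.sqrt_nonneg _)
      (tailMoment_nonneg _) (tailMoment_le (threshold_pos hL)) x
    change |tunedStat L x| * (x ^ 2 + 1) ≤ 4 * tailFourth τ x at h1
    have h2 := abs_sum_shift_exp_le t x
    change |w t x + w (-t) x - 2| ≤ t ^ 2 * x ^ 2 * (w t x + w (-t) x) + t ^ 2 at h2
    have hw0 : 0 ≤ w t x + w (-t) x := (add_pos (Real.exp_pos _) (Real.exp_pos _)).le
    have h3 := abs_nonneg (tunedStat L x)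
    rw [Real.norm_eq_abs, show w t x * tunedStat L x + w (-t) x * tunedStat L x
      - 2 * tunedStat L x = tunedStat L x * (w t x + w (-t) x - 2) by ring, abs_mul]
    calc |tunedStat L x| * |w t x + w (-t) x - 2|
        ≤ |tunedStat L x| * (t ^ 2 * x ^ 2 * (w t x + w (-t) x) + t ^ 2) := by gcongr
      _ ≤ |tunedStat L x| * (t ^ 2 * (x ^ 2 + 1) * (w t x + w (-t) x + 1)) := by
          gcongr
          nlinarith [mul_nonneg (sq_nonneg t) hw0, mul_nonneg (sq_nonneg t) (sq_nonneg x)]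
      _ = t ^ 2 * (w t x + w (-t) x + 1) * (|tunedStat L x| * (x ^ 2 + 1)) := by ring
      _ ≤ t ^ 2 * (w t x + w (-t) x + 1) * (4 * tailFourth τ x) := by gcongr
      _ = _ := by ring
  rw [integral_const_mul, integral_add (by exact (hK t).add (hK (-t))) (integrable_tailFourth 0 τ),
    integral_add (hK t) (hK (-t)), abs_mul, abs_two] at e4
  have e5 := e2 t ht
  have e6 := e2 (-t) (by rwa [neg_sq])
  nlinarith [sq_nonneg t]

/-- For `t² ≤ L` the quadratic bound applies. For larger `t` the statistic stays within `16 L` of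
`x²`, whose mean is `t² + 1`. -/
lemma tunedStat_bias (t : ℝ) :
    |∫ x, tunedStat L x ∂(gaussianReal t 1) - t ^ 2| ≤ 24577 * min (t ^ 2) L := by
  rcases le_total (t ^ 2) L with ht | ht
  · rw [min_eq_left ht]
    have h := abs_integral_tunedStat_le hL ht
    have := abs_sub (∫ x, tunedStat L x ∂(gaussianReal t 1)) (t ^ 2)
    rw [abs_of_nonneg (sq_nonneg t)] at this
    linarith
  · rw [min_eq_right ht]
    have h1 : |∫ x, (tunedStat L x - x ^ 2) ∂(gaussianReal t 1)| ≤ 16 * L := by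
      have := norm_integral_le_of_norm_le_const (μ := gaussianReal t 1)
        (f := fun x => tunedStat L x - x ^ 2) (C := 16 * L) (ae_of_all _ fun x => by
          have := abs_hardStat_sub_sq_le (four_le_threshold_sq hL)
            (tailMoment_nonneg _) (tailMoment_le (threshold_pos hL)) x
          rw [Real.sq_sqrt (by linarith)] at this
          rw [Real.norm_eq_abs]
          refine le_trans this (by linarith))
      simpa using this
    rw [integral_sub (integrable_tunedStat hL t) (integrable_sq_gaussianReal t),
      integral_sq_gaussianReal_shift] at h1
    rw [abs_le] at h1 ⊢
    constructor <;> linarith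

lemma tunedStat_variance (t : ℝ) :
    Var[tunedStat L; gaussianReal t 1] ≤ 8192 * L ^ 2 * Real.exp (-L) + 1312 * L * t ^ 2 := by
  rcases le_total (t ^ 2) L with ht | ht
  · have h1 := variance_le_integral_sub_sq (t := t) (measurable_tunedStat L) 0
    have h2 : ∫ x, (tunedStat L x - 0) ^ 2 ∂(gaussianReal t 1)
        ≤ ∫ x, 4 * tailFourth (√(8 * L)) x ∂(gaussianReal t 1) := by
      refine integral_mono_of_nonneg (ae_of_all _ fun x => sq_nonneg _)
        ((integrable_tailFourth _ _).const_mul 4) (ae_of_all _ fun x => ?_)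
      simp only [sub_zero]
      exact hardStat_sq_le (four_le_threshold_sq hL) (Real.sqrt_nonneg _)
        (tailMoment_nonneg _) (tailMoment_le (threshold_pos hL)) x
    rw [integral_const_mul] at h2
    have h3 := integral_tailFourth_le hL ht
    have h4 : 0 ≤ 1312 * L * t ^ 2 := by positivity
    linarith
  · have h1 := variance_le_integral_sub_sq (t := t) (measurable_tunedStat L) (t ^ 2)
    have hi : Integrable (fun x : ℝ => (x ^ 2 - t ^ 2) ^ 2) (gaussianReal t 1) :=
      integrable_of_le_quartic (C := 2 + 2 * t ^ 4) (by fun_prop) fun x => by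
        rw [abs_of_nonneg (by positivity)]
        nlinarith [sq_nonneg (x ^ 2 + t ^ 2), mul_nonneg (sq_nonneg (t ^ 2)) (sq_nonneg (x ^ 2))]
    have h2 : ∫ x, (tunedStat L x - t ^ 2) ^ 2 ∂(gaussianReal t 1)
        ≤ ∫ x, (512 * L ^ 2 + 2 * (x ^ 2 - t ^ 2) ^ 2) ∂(gaussianReal t 1) := by
      refine integral_mono_of_nonneg (ae_of_all _ fun x => sq_nonneg _)
        ((integrable_const _).add (hi.const_mul 2)) (ae_of_all _ fun x => ?_)
      have h3 := abs_hardStat_sub_sq_le (four_le_threshold_sq hL)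
        (tailMoment_nonneg _) (tailMoment_le (threshold_pos hL)) x
      rw [Real.sq_sqrt (by linarith)] at h3
      change |tunedStat L x - x ^ 2| ≤ 2 * (8 * L) at h3
      have h4 : (tunedStat L x - x ^ 2) ^ 2 ≤ (2 * (8 * L)) ^ 2 := by
        rw [← sq_abs]; gcongr
      simp only
      nlinarith [sq_nonneg ((tunedStat L x - x ^ 2) - (x ^ 2 - t ^ 2))]
    rw [integral_add (integrable_const _) (hi.const_mul 2), integral_const_mul 2] at h2
    simp only [integral_const, probReal_univ, smul_eq_mul, one_mul] at h2
    have h3 := integral_sq_sub_sq_le t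
    have h4 : 0 ≤ 8192 * L ^ 2 * Real.exp (-L) := by positivity
    -- The total is `512 L² + 192 + 16 t²`; since `t² ≥ L ≥ 1/2`, it is at most `(512 + 768 + 32) L
    -- t²`.
    nlinarith [mul_le_mul_of_nonneg_left ht (show 0 ≤ L by linarith)]

end

/-! ### From estimating the squared norm to estimating the norm -/

/-- With `w = √Z₊`, truncation only helps, so `|w - T| (w + T) ≤ |Z - T²|`. The two bounds use `w +
T ≥ |w - T|` and `w + T ≥ T`. -/
lemma sqrt_posPart_sub_sq_le {Z T A : ℝ} (hT : 0 ≤ T) (hA : 0 < A) :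
    (√(max Z 0) - T) ^ 2 ≤ (A + (Z - T ^ 2) ^ 2 / A) / 2 ∧
      (A ≤ T ^ 2 → (√(max Z 0) - T) ^ 2 ≤ (Z - T ^ 2) ^ 2 / T ^ 2) := by
  set w := √(max Z 0) with hw
  have hw0 : 0 ≤ w := Real.sqrt_nonneg _
  have hw2 : w ^ 2 = max Z 0 := Real.sq_sqrt (le_max_right _ _)
  have h1 : |w ^ 2 - T ^ 2| ≤ |Z - T ^ 2| := by
    rw [hw2]
    rcases le_total Z 0 with hZ | hZ
    · rw [max_eq_right hZ, zero_sub, abs_neg, abs_of_nonneg (sq_nonneg T),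
        abs_of_nonpos (by nlinarith [sq_nonneg T])]
      linarith
    · rw [max_eq_left hZ]
  have h2 : |w ^ 2 - T ^ 2| = |w - T| * (w + T) := by
    rw [← abs_of_nonneg (add_nonneg hw0 hT), ← abs_mul]; congr 1; ring
  have h3 : |w - T| ≤ w + T := by rw [abs_le]; constructor <;> linarith
  constructor
  · have h4 : (w - T) ^ 2 ≤ |Z - T ^ 2| := by
      rw [← sq_abs]; nlinarith [abs_nonneg (w - T)]
    refine h4.trans ?_
    rw [← sq_abs (Z - T ^ 2), le_div_iff₀ two_pos, ← mul_le_mul_iff_left₀ hA, add_mul,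
      div_mul_cancel₀ _ hA.ne']
    nlinarith [sq_nonneg (A - |Z - T ^ 2|)]
  · intro hAT
    rw [le_div_iff₀ (hA.trans_le hAT), ← sq_abs (w - T), ← sq_abs (Z - T ^ 2), ← mul_pow]
    refine pow_le_pow_left₀ (by positivity) ?_ 2
    nlinarith [abs_nonneg (w - T)]

/-- A bound for the mean square error of `√Z₊` as an estimator of `T` from that of `Z` as an
estimator of `T²`. -/
lemma lintegral_sqrt_posPart_sub_sq_le {α : Type*} [MeasurableSpace α] {μ : Measure α}
    [IsProbabilityMeasure μ] {Z : α → ℝ} {T A K : ℝ} (hT : 0 ≤ T) (hA : 0 < A) (hK : 1 / 2 ≤ K)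
    (hi : Integrable (fun x => (Z x - T ^ 2) ^ 2) μ)
    (h : ∫ x, (Z x - T ^ 2) ^ 2 ∂μ ≤ K * (A ^ 2 + A * T ^ 2)) :
    ∫⁻ x, ENNReal.ofReal ((√(max (Z x) 0) - T) ^ 2) ∂μ ≤ ENNReal.ofReal (2 * K * A) := by
  have key : ∀ a b : ℝ, 0 ≤ a → 0 ≤ b →
      (∀ x, (√(max (Z x) 0) - T) ^ 2 ≤ a + b * (Z x - T ^ 2) ^ 2) →
      a + b * (K * (A ^ 2 + A * T ^ 2)) ≤ 2 * K * A →
      ∫⁻ x, ENNReal.ofReal ((√(max (Z x) 0) - T) ^ 2) ∂μ ≤ ENNReal.ofReal (2 * K * A) := by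
    intro a b ha hb hle hab
    calc ∫⁻ x, ENNReal.ofReal ((√(max (Z x) 0) - T) ^ 2) ∂μ
        ≤ ∫⁻ x, ENNReal.ofReal (a + b * (Z x - T ^ 2) ^ 2) ∂μ :=
          lintegral_mono fun x => ENNReal.ofReal_le_ofReal (hle x)
      _ = ENNReal.ofReal (∫ x, (a + b * (Z x - T ^ 2) ^ 2) ∂μ) := by
          rw [ofReal_integral_eq_lintegral_ofReal (by exact (integrable_const _).add (hi.const_mul b))]
          exact ae_of_all _ fun x => by simp only [Pi.zero_apply]; positivity
      _ ≤ ENNReal.ofReal (2 * K * A) := by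
          apply ENNReal.ofReal_le_ofReal
          rw [integral_add (integrable_const _) (hi.const_mul b), integral_const_mul b]
          simp only [integral_const, probReal_univ, smul_eq_mul, one_mul]
          nlinarith
  -- Small `T` gives `A / 2 + K (A + T²) / 2 ≤ 2 K A`, where `K ≥ 1/2` enters; large `T` gives `K A²
  -- / T² + K A`.
  rcases le_total (T ^ 2) A with hTA | hTA
  · refine key (A / 2) (1 / (2 * A)) (by positivity) (by positivity) (fun x => ?_) ?_
    · refine (sqrt_posPart_sub_sq_le hT hA).1.trans (le_of_eq ?_)
      field_simp
    · have : 1 / (2 * A) * (K * (A ^ 2 + A * T ^ 2)) = K * (A + T ^ 2) / 2 := by field_simp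
      rw [this]; nlinarith
  · have hT2 : 0 < T ^ 2 := hA.trans_le hTA
    refine key 0 (1 / T ^ 2) le_rfl (by positivity) (fun x => ?_) ?_
    · refine ((sqrt_posPart_sub_sq_le hT hA).2 hTA).trans (le_of_eq ?_)
      ring
    · rw [zero_add, one_div_mul_eq_div, div_le_iff₀ hT2]
      nlinarith [mul_nonneg (mul_nonneg (show 0 ≤ K by linarith) hA.le) (sub_nonneg.2 hTA)]

/-- Bias-variance bound for a sum of functions of independent Gaussian coordinates. -/
lemma integral_sum_sub_sq_le {d : ℕ} {t : Fin d → ℝ} {h : ℝ → ℝ}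
    (hL2 : ∀ s, MemLp h 2 (gaussianReal s 1)) :
    Integrable (fun x : Fin d → ℝ => (∑ j, h (x j) - ∑ j, t j ^ 2) ^ 2) (shiftLaw t) ∧
      ∫ x, (∑ j, h (x j) - ∑ j, t j ^ 2) ^ 2 ∂(shiftLaw t)
        ≤ ∑ j, Var[h; gaussianReal (t j) 1]
          + (∑ j, |∫ x, h x ∂(gaussianReal (t j) 1) - t j ^ 2|) ^ 2 := by
  have hj : ∀ j, MemLp (fun x : Fin d → ℝ => h (x j)) 2 (shiftLaw t) := fun j =>
    (hL2 (t j)).comp_measurePreserving (measurePreserving_eval _ j)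
  have hsum : MemLp (fun x : Fin d → ℝ => ∑ j, h (x j)) 2 (shiftLaw t) :=
    memLp_finsetSum _ fun j _ => hj j
  have hsub : MemLp (fun x : Fin d → ℝ => ∑ j, h (x j) - ∑ j, t j ^ 2) 2 (shiftLaw t) :=
    hsum.sub (memLp_const _)
  refine ⟨hsub.integrable_sq, ?_⟩
  have h1 := variance_eq_sub hsub
  rw [variance_sub_const hsum.aestronglyMeasurable] at h1
  have h2 : Var[fun x : Fin d → ℝ => ∑ j, h (x j); shiftLaw t]
      = ∑ j, Var[h; gaussianReal (t j) 1] := by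
    rw [← variance_sum_pi fun j => hL2 (t j)]
    congr 1
    ext x
    simp
  have h3 : ∫ x, (∑ j, h (x j) - ∑ j, t j ^ 2) ∂(shiftLaw t)
      = ∑ j, (∫ x, h x ∂(gaussianReal (t j) 1) - t j ^ 2) := by
    rw [integral_sub (hsum.integrable (by norm_num)) (integrable_const _),
      integral_finsetSum _ fun j _ => (hj j).integrable (by norm_num), Finset.sum_sub_distrib]
    simp only [integral_const, probReal_univ, smul_eq_mul, one_mul]
    congr 1
    refine Finset.sum_congr rfl fun j _ => ?_
    exact integral_comp_eval (μ := fun j => gaussianReal (t j) 1)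
      (hL2 (t j)).aestronglyMeasurable
  rw [h2, h3] at h1
  have h4 : (∑ j, (∫ x, h x ∂(gaussianReal (t j) 1) - t j ^ 2)) ^ 2
      ≤ (∑ j, |∫ x, h x ∂(gaussianReal (t j) 1) - t j ^ 2|) ^ 2 := by
    rw [← sq_abs]
    exact pow_le_pow_left₀ (abs_nonneg _) (Finset.abs_sum_le_sum_abs _ _) 2
  simp only [Pi.pow_apply] at h1
  linarith

lemma l2Norm_mul {d : ℕ} {σ : ℝ} (hσ : 0 ≤ σ) (t : Fin d → ℝ) :
    l2Norm (fun j => σ * t j) = σ * √(∑ j, t j ^ 2) := by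
  simp only [l2Norm, mul_pow, ← Finset.mul_sum]
  rw [Real.sqrt_mul (sq_nonneg _), Real.sqrt_sq hσ]

/-- Common to the dense and sparse regimes, with `A` the rate divided by `σ²`. -/
lemma sqRisk_le {d : ℕ} {σ A K : ℝ} {t : Fin d → ℝ} {h : ℝ → ℝ} {N : (Fin d → ℝ) → ℝ}
    (hσ : 0 < σ) (hA : 0 < A) (hK : 1 / 2 ≤ K) (hNm : Measurable N)
    (hN : ∀ x : Fin d → ℝ, N (fun j => σ * x j) = σ * √(max (∑ j, h (x j)) 0))
    (hL2 : ∀ s, MemLp h 2 (gaussianReal s 1))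
    (hvar : ∑ j, Var[h; gaussianReal (t j) 1]
      + (∑ j, |∫ x, h x ∂(gaussianReal (t j) 1) - t j ^ 2|) ^ 2
        ≤ K * (A ^ 2 + A * ∑ j, t j ^ 2)) :
    sqRisk σ l2Norm N (fun j => σ * t j) ≤ ENNReal.ofReal (2 * K * (σ ^ 2 * A)) := by
  rw [sqRisk_mul _ _ _ hNm]
  have hT2 : √(∑ j, t j ^ 2) ^ 2 = ∑ j, t j ^ 2 :=
    Real.sq_sqrt (Finset.sum_nonneg fun j _ => sq_nonneg _)
  obtain ⟨hi, hle⟩ := integral_sum_sub_sq_le (t := t) hL2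
  have key := lintegral_sqrt_posPart_sub_sq_le (μ := shiftLaw t) (Z := fun x => ∑ j, h (x j))
    (T := √(∑ j, t j ^ 2)) (Real.sqrt_nonneg _) hA hK (by rwa [hT2])
    (by rw [hT2]; exact hle.trans hvar)
  have e : ∀ x : Fin d → ℝ, ENNReal.ofReal ((N (fun j => σ * x j) - l2Norm fun j => σ * t j) ^ 2)
      = ENNReal.ofReal (σ ^ 2) *
        ENNReal.ofReal ((√(max (∑ j, h (x j)) 0) - √(∑ j, t j ^ 2)) ^ 2) := by
    intro x
    rw [hN, l2Norm_mul hσ.le, ← mul_sub, mul_pow, ENNReal.ofReal_mul (sq_nonneg _)]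
  simp_rw [e]
  rw [lintegral_const_mul' _ _ ENNReal.ofReal_ne_top]
  refine (mul_le_mul_right key _).trans (le_of_eq ?_)
  rw [← ENNReal.ofReal_mul (sq_nonneg _)]
  congr 1; ring

lemma dense_bias_variance {d : ℕ} (hd : 1 ≤ d) (t : Fin d → ℝ) :
    ∑ j, Var[fun x => x ^ 2 - 1; gaussianReal (t j) 1]
      + (∑ j, |∫ x, (x ^ 2 - 1) ∂(gaussianReal (t j) 1) - t j ^ 2|) ^ 2
        ≤ 96 * (√(d : ℝ) ^ 2 + √(d : ℝ) * ∑ j, t j ^ 2) := by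
  have h1 : ∀ s : ℝ, ∫ x, (x ^ 2 - 1) ∂(gaussianReal s 1) - s ^ 2 = 0 := by
    intro s
    rw [integral_sub (integrable_sq_gaussianReal s) (integrable_const _),
      integral_sq_gaussianReal_shift]
    simp
  have h2 : ∀ s : ℝ, Var[fun x => x ^ 2 - 1; gaussianReal s 1] ≤ 96 + 8 * s ^ 2 := by
    intro s
    refine (variance_le_integral_sub_sq (by fun_prop) (s ^ 2 - 1)).trans ?_
    refine (le_of_eq ?_).trans (integral_sq_sub_sq_le s)
    congr 1; ext x; ring
  have hS : 0 ≤ ∑ j, t j ^ 2 := Finset.sum_nonneg fun j _ => sq_nonneg _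
  have hd1 : 1 ≤ √(d : ℝ) := Real.one_le_sqrt.2 (by exact_mod_cast hd)
  simp_rw [h1, abs_zero, Finset.sum_const_zero]
  calc ∑ j, Var[fun x => x ^ 2 - 1; gaussianReal (t j) 1] + 0 ^ 2
      ≤ ∑ j, (96 + 8 * t j ^ 2) + 0 ^ 2 := by gcongr with j; exact h2 _
    _ = 96 * (d : ℝ) + 8 * ∑ j, t j ^ 2 := by
        rw [Finset.sum_add_distrib, ← Finset.mul_sum]; simp; ring
    _ ≤ _ := by
        rw [Real.sq_sqrt (Nat.cast_nonneg d)]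
        nlinarith

lemma sparse_bias_variance {d m : ℕ} (hm : 1 ≤ m) (hmd : m ^ 2 ≤ d) {L : ℝ}
    (hL : L = Real.log (1 + d / (m : ℝ) ^ 2)) (hL2 : 1 / 2 ≤ L) (t : Fin d → ℝ)
    (ht : ∑ j, min (t j ^ 2) L ≤ 2 * m * L) :
    ∑ j, Var[tunedStat L; gaussianReal (t j) 1]
      + (∑ j, |∫ x, tunedStat L x ∂(gaussianReal (t j) 1) - t j ^ 2|) ^ 2
        ≤ (8192 + 1312 + 49154 ^ 2) * ((m * L) ^ 2 + m * L * ∑ j, t j ^ 2) := by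
  have hm0 : (1 : ℝ) ≤ m := by exact_mod_cast hm
  have hS : 0 ≤ ∑ j, t j ^ 2 := Finset.sum_nonneg fun j _ => sq_nonneg _
  have hd0 : 0 < (d : ℝ) := by
    have : 0 < d := lt_of_lt_of_le (by positivity) hmd
    exact_mod_cast this
  have hL0 : 0 ≤ L := by linarith
  -- The calibration of `L`: `exp L = 1 + d / m²`, so the null coordinates have total variance of
  -- order `(m L)²`.
  have hexp : d * Real.exp (-L) ≤ (m : ℝ) ^ 2 := by
    rw [Real.exp_neg, hL, Real.exp_log (by positivity), ← div_eq_mul_inv,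
      div_le_iff₀ (by positivity), mul_add, mul_div_cancel₀ _ (by positivity)]
    nlinarith
  have h1 : ∑ j, |∫ x, tunedStat L x ∂(gaussianReal (t j) 1) - t j ^ 2| ≤ 49154 * (m * L) := by
    calc _ ≤ ∑ j, 24577 * min (t j ^ 2) L := Finset.sum_le_sum fun j _ => tunedStat_bias hL2 _
      _ ≤ _ := by rw [← Finset.mul_sum]; linarith
  have h2 : (∑ j, |∫ x, tunedStat L x ∂(gaussianReal (t j) 1) - t j ^ 2|) ^ 2
      ≤ (49154 * (m * L)) ^ 2 :=
    pow_le_pow_left₀ (Finset.sum_nonneg fun j _ => abs_nonneg _) h1 2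
  have h3 : ∑ j, Var[tunedStat L; gaussianReal (t j) 1]
      ≤ 8192 * (m * L) ^ 2 + 1312 * (m * L * ∑ j, t j ^ 2) := by
    calc _ ≤ ∑ j, (8192 * L ^ 2 * Real.exp (-L) + 1312 * L * t j ^ 2) :=
          Finset.sum_le_sum fun j _ => tunedStat_variance hL2 _
      _ = 8192 * L ^ 2 * (d * Real.exp (-L)) + 1312 * (L * ∑ j, t j ^ 2) := by
          rw [Finset.sum_add_distrib, Finset.sum_const, Finset.card_univ, Fintype.card_fin,
            nsmul_eq_mul, ← Finset.mul_sum]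
          ring
      _ ≤ 8192 * L ^ 2 * (m : ℝ) ^ 2 + 1312 * (m * (L * ∑ j, t j ^ 2)) := by
          have h5 := le_mul_of_one_le_left (mul_nonneg hL0 hS) hm0
          have h6 := mul_le_mul_of_nonneg_left hexp (show 0 ≤ 8192 * L ^ 2 by positivity)
          linarith
      _ = _ := by ring
  have h4 : 0 ≤ m * L * ∑ j, t j ^ 2 := mul_nonneg (by positivity) hS
  have h5 : 0 ≤ (m * L) ^ 2 := by positivity
  nlinarith

/-! ### Geometry of the ball and the effective sparsity -/

/-- Split the minimum into its powers `q / 2` and `1 - q / 2`, and bound one by `x²`, the other by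
`u`; this needs `q < 2`. -/
lemma min_sq_le {q u : ℝ} (hq0 : 0 < q) (hq2 : q < 2) (hu : 0 < u) (x : ℝ) :
    min (x ^ 2) u ≤ |x| ^ q * u ^ (1 - q / 2) := by
  have hx : (x ^ 2) ^ (q / 2) = |x| ^ q := by
    rw [← sq_abs, ← Real.rpow_natCast, ← Real.rpow_mul (abs_nonneg x)]
    congr 1; push_cast; ring
  have h0 : 0 ≤ min (x ^ 2) u := le_min (sq_nonneg _) hu.le
  rw [← hx]
  calc min (x ^ 2) u = min (x ^ 2) u ^ (q / 2) * min (x ^ 2) u ^ (1 - q / 2) := by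
        rw [← Real.rpow_add' h0 (by ring_nf; norm_num)]
        ring_nf; simp
    _ ≤ (x ^ 2) ^ (q / 2) * u ^ (1 - q / 2) := by
        gcongr
        · exact min_le_left _ _
        · linarith
        · exact min_le_right _ _

lemma sum_rpow_le_of_mem {d : ℕ} {q r : ℝ} (hq : 0 < q) {θ : Fin d → ℝ}
    (hθ : θ ∈ lqBall d q r) : ∑ j, |θ j| ^ q ≤ r ^ q := by
  have h0 : 0 ≤ ∑ j, |θ j| ^ q := Finset.sum_nonneg fun j _ => Real.rpow_nonneg (abs_nonneg _) _
  have h1 : (∑ j, |θ j| ^ q) ^ (1 / q) ≤ r := hθ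
  have h2 := Real.rpow_le_rpow (Real.rpow_nonneg h0 _) h1 hq.le
  rwa [← Real.rpow_mul h0, one_div_mul_cancel hq.ne', Real.rpow_one] at h2

lemma sum_sq_le_of_mem {d : ℕ} {q r : ℝ} (hq0 : 0 < q) (hq2 : q < 2) (hr : 0 < r)
    {θ : Fin d → ℝ} (hθ : θ ∈ lqBall d q r) : ∑ j, θ j ^ 2 ≤ r ^ 2 := by
  have h := sum_rpow_le_of_mem hq0 hθ
  have h1 : ∀ j, θ j ^ 2 ≤ r ^ 2 := by
    intro j
    have h2 : |θ j| ^ q ≤ r ^ q := (Finset.single_le_sum (f := fun j => |θ j| ^ q)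
      (fun j _ => Real.rpow_nonneg (abs_nonneg _) _) (Finset.mem_univ j)).trans h
    rw [← sq_abs]
    exact pow_le_pow_left₀ (abs_nonneg _)
      ((Real.rpow_le_rpow_iff (abs_nonneg _) hr.le hq0).1 h2) 2
  calc ∑ j, θ j ^ 2 = ∑ j, min (θ j ^ 2) (r ^ 2) :=
        Finset.sum_congr rfl fun j _ => (min_eq_left (h1 j)).symm
    _ ≤ ∑ j, |θ j| ^ q * (r ^ 2) ^ (1 - q / 2) :=
        Finset.sum_le_sum fun j _ => min_sq_le hq0 hq2 (by positivity) _
    _ ≤ r ^ q * (r ^ 2) ^ (1 - q / 2) := by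
        rw [← Finset.sum_mul]; gcongr
    _ = r ^ 2 := by
        rw [← Real.rpow_natCast r 2, ← Real.rpow_mul hr.le, ← Real.rpow_add hr]
        congr 1; push_cast; ring

/-- Failure at `m + 1`, with the logarithm decreasing in `m`, gives `r^q ≤ σ^q L^(q/2) (m + 1)`.
Interpolation turns this into `(m + 1) L ≤ 2 m L`. -/
lemma sum_min_le_of_mem {d m : ℕ} {q r σ L : ℝ} (hq0 : 0 < q) (hq2 : q < 2) (hr : 0 < r)
    (hσ : 0 < σ) (hm : 1 ≤ m) (hL : L = Real.log (1 + d / (m : ℝ) ^ 2)) (hL0 : 0 < L)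
    (hfail : ¬ SparsityIneq d q r σ (m + 1)) {t : Fin d → ℝ}
    (ht : (fun j => σ * t j) ∈ lqBall d q r) : ∑ j, min (t j ^ 2) L ≤ 2 * m * L := by
  have hm0 : (1 : ℝ) ≤ m := by exact_mod_cast hm
  have hM : (0 : ℝ) < ((m + 1 : ℕ) : ℝ) := by positivity
  have h1 : Real.log (1 + d / ((m + 1 : ℕ) : ℝ) ^ 2) ≤ L := by
    rw [hL]
    gcongr
    omega
  have h2 : r ^ 2 ≤ σ ^ 2 * L * ((m + 1 : ℕ) : ℝ) ^ (2 / q) := by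
    have h := not_le.1 hfail
    rw [neg_div, Real.rpow_neg hM.le, ← div_eq_mul_inv, div_lt_iff₀ (Real.rpow_pos_of_pos hM _)] at h
    refine h.le.trans ?_
    gcongr
  have h3 : r ^ q ≤ σ ^ q * L ^ (q / 2) * (m + 1) := by
    have h := Real.rpow_le_rpow (sq_nonneg r) h2 (show 0 ≤ q / 2 by positivity)
    rw [Real.mul_rpow (by positivity) (by positivity), Real.mul_rpow (by positivity) hL0.le,
      ← Real.rpow_mul hM.le, ← Real.rpow_natCast r 2, ← Real.rpow_natCast σ 2,
      ← Real.rpow_mul hr.le, ← Real.rpow_mul hσ.le,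
      show ((2 : ℕ) : ℝ) * (q / 2) = q by push_cast; ring,
      show 2 / q * (q / 2) = 1 by field_simp, Real.rpow_one] at h
    push_cast at h
    exact h
  have h4 := sum_rpow_le_of_mem hq0 ht
  simp only [abs_mul, abs_of_pos hσ, Real.mul_rpow hσ.le (abs_nonneg _)] at h4
  rw [← Finset.mul_sum] at h4
  have hσq := Real.rpow_pos_of_pos hσ q
  have h5 : ∑ j, |t j| ^ q ≤ L ^ (q / 2) * (m + 1) := by
    have := h4.trans h3
    rw [mul_assoc] at this
    exact le_of_mul_le_mul_left this hσq
  calc ∑ j, min (t j ^ 2) L ≤ ∑ j, |t j| ^ q * L ^ (1 - q / 2) :=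
        Finset.sum_le_sum fun j _ => min_sq_le hq0 hq2 hL0 _
    _ ≤ L ^ (q / 2) * (m + 1) * L ^ (1 - q / 2) := by rw [← Finset.sum_mul]; gcongr
    _ = (m + 1) * L := by
        rw [mul_right_comm, ← Real.rpow_add hL0]
        ring_nf; simp; ring
    _ ≤ 2 * m * L := by gcongr; linarith

lemma sparsityIneq_of_le {d k : ℕ} {q r σ : ℝ} (hk : 1 ≤ k) (h : (k : ℕ∞) ≤ effSparsity d q r σ) :
    SparsityIneq d q r σ k := by
  -- Passing to the strict inequality `n < m` yields an admissible `s > n`, even if the supremum is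
  -- `⊤`.
  obtain ⟨n, rfl⟩ : ∃ n, k = n + 1 := ⟨k - 1, by omega⟩
  have h1 : (n : ℕ∞) < effSparsity d q r σ := lt_of_lt_of_le (by exact_mod_cast n.lt_succ_self) h
  simp only [effSparsity, lt_iSup_iff] at h1
  obtain ⟨s, hs, hns⟩ := h1
  exact hs _ hk (by exact_mod_cast hns)

lemma not_sparsityIneq_succ {d m : ℕ} {q r σ : ℝ} (h : effSparsity d q r σ = m) :
    ¬ SparsityIneq d q r σ (m + 1) := by
  intro h1
  have h2 : ((m + 1 : ℕ) : ℕ∞) ≤ effSparsity d q r σ := by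
    refine le_iSup₂_of_le (m + 1) (fun k hk hkm => ?_) le_rfl
    rcases Nat.lt_or_ge m k with hlt | hge
    · obtain rfl : k = m + 1 := by omega
      exact h1
    · exact sparsityIneq_of_le hk (by rw [h]; exact_mod_cast hge)
  rw [h] at h2
  have : m + 1 ≤ m := by exact_mod_cast h2
  omega

lemma half_le_log {d k : ℕ} (hk : 1 ≤ k) (hkd : k ^ 2 ≤ d) :
    1 / 2 ≤ Real.log (1 + d / (k : ℝ) ^ 2) := by
  have hk0 : (0 : ℝ) < k := by exact_mod_cast hk
  have h1 : (1 : ℝ) ≤ d / (k : ℝ) ^ 2 := by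
    rw [one_le_div (by positivity)]; exact_mod_cast hkd
  have h2 := Real.log_two_gt_d9
  have h3 := Real.log_le_log two_pos (show (2 : ℝ) ≤ 1 + d / (k : ℝ) ^ 2 by linarith)
  linarith

/-- The minimax lower bound at a sparsity level where `SparsityIneq` holds. -/
lemma le_minimaxRisk_of_sparsityIneq {d k : ℕ} {q r σ : ℝ} (hq : 0 < q) (hr : 0 < r) (hσ : 0 < σ)
    (hk : 1 ≤ k) (hkd : k ^ 2 ≤ d) (h : SparsityIneq d q r σ k) :
    ENNReal.ofReal (σ ^ 2 * k * Real.log (1 + d / (k : ℝ) ^ 2) / 24)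
      ≤ minimaxRisk σ l2Norm (lqBall d q r) := by
  have hL := half_le_log hk hkd
  set L := Real.log (1 + d / (k : ℝ) ^ 2) with hLdef
  have ha : √(L / 4) ^ 2 = L / 4 := Real.sq_sqrt (by linarith)
  have := le_minimaxRisk hq hσ hr hk hkd (Real.sqrt_nonneg (L / 4)) ha.le (by
    rw [ha]
    have h1 : σ ^ 2 * L ≤ r ^ 2 * (k : ℝ) ^ (-2 / q) := h
    have h2 : 0 ≤ σ ^ 2 * L := by positivity
    linarith)
  rw [ha] at this
  convert this using 2
  ring

/-! ### The three regimes -/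

lemma measurable_quadStat (d : ℕ) (q r σ : ℝ) : Measurable (quadStat d q r σ) := by
  unfold quadStat
  split_ifs
  · fun_prop
  · refine Finset.measurable_fun_sum _ fun j _ => Measurable.ite
      (measurableSet_lt measurable_const (by fun_prop)) (by fun_prop) measurable_const
  · exact measurable_const

lemma measurable_normStat (d : ℕ) (q r σ : ℝ) : Measurable (normStat d q r σ) := by
  unfold normStat
  exact ((measurable_quadStat d q r σ).max measurable_const).sqrt

lemma maxRisk_le_of_mul {d : ℕ} {q r σ : ℝ} (hσ : 0 < σ) {N : (Fin d → ℝ) → ℝ} {R : ℝ≥0∞}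
    (h : ∀ t : Fin d → ℝ, (fun j => σ * t j) ∈ lqBall d q r →
      sqRisk σ l2Norm N (fun j => σ * t j) ≤ R) :
    maxRisk σ l2Norm (lqBall d q r) N ≤ R := by
  refine iSup₂_le fun θ hθ => ?_
  have e : (fun j => σ * (θ j / σ)) = θ := by
    ext j; field_simp
  have := h (fun j => θ j / σ) (by rwa [e])
  rwa [e] at this

lemma sqrt_max_sq_mul {σ : ℝ} (hσ : 0 < σ) (Z : ℝ) :
    √(max (σ ^ 2 * Z) 0) = σ * √(max Z 0) := by
  have : max (σ ^ 2 * Z) 0 = σ ^ 2 * max Z 0 := by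
    rw [mul_max_of_nonneg _ _ (sq_nonneg σ), mul_zero]
  rw [this, Real.sqrt_mul (sq_nonneg _), Real.sqrt_sq hσ.le]

lemma condSecondMoment_eq {d m : ℕ} {L : ℝ} (hL : L = Real.log (1 + d / (m : ℝ) ^ 2))
    (hL0 : 0 ≤ L) : condSecondMoment d m = tailMoment (√(8 * L)) := by
  rw [condSecondMoment, tailMoment, ← hL]
  congr 2
  ext x
  simp only [Set.mem_ofPred_eq]
  rw [← Real.sqrt_sq_eq_abs, Real.sqrt_lt_sqrt_iff (by positivity)]

lemma dense_case {d : ℕ} {q r σ : ℝ} (hq0 : 0 < q) (hd : 1 ≤ d) (hr : 0 < r) (hσ : 0 < σ)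
    (h : (d : ℕ∞) < effSparsity d q r σ ^ 2) :
    maxRisk σ l2Norm (lqBall d q r) (normStat d q r σ) ≤ ENNReal.ofReal (192 * (σ ^ 2 * √(d : ℝ)))
    ∧ ENNReal.ofReal (1 / 96 * (σ ^ 2 * √(d : ℝ))) ≤ minimaxRisk σ l2Norm (lqBall d q r) := by
  constructor
  · refine maxRisk_le_of_mul hσ fun t _ => ?_
    have := sqRisk_le (t := t) (h := fun x => x ^ 2 - 1) (N := normStat d q r σ) (K := 96)
      (A := √(d : ℝ)) hσ (Real.sqrt_pos.2 (by exact_mod_cast hd)) (by norm_num)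
      (measurable_normStat _ _ _ _) (fun x => ?_)
      (fun s => memLp_two_of_le_quadratic (C := 1) (by fun_prop) fun x => ?_)
      (dense_bias_variance hd t)
    · convert this using 2
      ring
    · rw [← sqrt_max_sq_mul hσ, normStat, quadStat, if_pos h]
      congr 2
      simp only [mul_pow, Finset.sum_sub_distrib, ← Finset.mul_sum]
      simp; ring
    · rw [abs_le]; constructor <;> nlinarith [sq_nonneg x]
  -- Here `k = ⌊√d⌋` is at most the effective sparsity, `√d ≤ 2 k`, and the logarithm is at least
  -- `1/2`; hence the factor `4` lost between `1/24` and `1/96`.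
  · set k := Nat.sqrt d with hk
    have hk1 : 1 ≤ k := Nat.le_sqrt.2 (by simpa using hd)
    have hkd : k ^ 2 ≤ d := Nat.sqrt_le' d
    have hle : (k : ℕ∞) ≤ effSparsity d q r σ := by
      by_contra hlt
      have h1 : effSparsity d q r σ ^ 2 ≤ (k : ℕ∞) ^ 2 := pow_le_pow_left₀ (by simp) (not_le.1 hlt).le 2
      have h2 : (d : ℕ∞) < (k : ℕ∞) ^ 2 := h.trans_le h1
      have h3 : d < k ^ 2 := by exact_mod_cast h2
      omega
    refine le_trans (ENNReal.ofReal_le_ofReal ?_)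
      (le_minimaxRisk_of_sparsityIneq hq0 hr hσ hk1 hkd (sparsityIneq_of_le hk1 hle))
    have hL := half_le_log hk1 hkd
    have h4 : √(d : ℝ) ≤ 2 * k := by
      apply Real.sqrt_le_iff.2 ⟨by positivity, ?_⟩
      have h5 : d < (k + 1) ^ 2 := Nat.lt_succ_sqrt' d
      have h6 : d ≤ (2 * k) ^ 2 := by nlinarith
      exact_mod_cast h6
    have h7 : (2 * k : ℝ) * (1 / 2) ≤ 2 * k * Real.log (1 + d / (k : ℝ) ^ 2) := by gcongr
    have h8 : σ ^ 2 * √(d : ℝ) ≤ σ ^ 2 * (4 * (k * Real.log (1 + d / (k : ℝ) ^ 2))) := by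
      gcongr; linarith
    linarith

lemma sparse_case {d m : ℕ} {q r σ : ℝ} (hq0 : 0 < q) (hq2 : q < 2) (hr : 0 < r) (hσ : 0 < σ)
    (hm : effSparsity d q r σ = m) (hm1 : 1 ≤ m) (hmd : m ^ 2 ≤ d) :
    maxRisk σ l2Norm (lqBall d q r) (normStat d q r σ) ≤ ENNReal.ofReal
      (2 * (8192 + 1312 + 49154 ^ 2) * (σ ^ 2 * m * Real.log (1 + d / (m : ℝ) ^ 2)))
    ∧ ENNReal.ofReal (1 / 96 * (σ ^ 2 * m * Real.log (1 + d / (m : ℝ) ^ 2)))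
      ≤ minimaxRisk σ l2Norm (lqBall d q r) := by
  have hL2 := half_le_log hm1 hmd
  have hm0 : (0 : ℝ) < m := by exact_mod_cast hm1
  constructor
  · obtain ⟨L, hL⟩ : ∃ L, L = Real.log (1 + d / (m : ℝ) ^ 2) := ⟨_, rfl⟩
    rw [← hL] at hL2 ⊢
    refine maxRisk_le_of_mul hσ fun t ht => ?_
    have hmin := sum_min_le_of_mem hq0 hq2 hr hσ hm1 hL (by linarith) (not_sparsityIneq_succ hm) ht
    have := sqRisk_le (t := t) (h := tunedStat L) (N := normStat d q r σ) (A := m * L)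
      hσ (by positivity) (by norm_num)
      (measurable_normStat _ _ _ _) (fun x => ?_) (memLp_tunedStat hL2)
      (sparse_bias_variance hm1 hmd hL hL2 t hmin)
    · convert this using 2
      ring
    · have h1 : ¬ ((d : ℕ∞) < effSparsity d q r σ ^ 2) := by
        rw [hm, not_lt]; exact_mod_cast hmd
      have h2 : 1 ≤ effSparsity d q r σ := by rw [hm]; exact_mod_cast hm1
      rw [← sqrt_max_sq_mul hσ, normStat, quadStat, if_neg h1, if_pos h2, hm, ENat.toNat_natCast,
        ← hL, condSecondMoment_eq hL (by linarith), Finset.mul_sum]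
      congr 2
      refine Finset.sum_congr rfl fun j _ => ?_
      have h3 : 2 * σ * √(2 * L) = σ * √(8 * L) := by
        rw [show 8 * L = 2 ^ 2 * (2 * L) by ring, Real.sqrt_mul (by norm_num) (2 * L),
          Real.sqrt_sq (by norm_num)]
        ring
      rw [h3, abs_mul, abs_of_pos hσ]
      simp only [mul_lt_mul_iff_right₀ hσ, tunedStat, hardStat]
      split_ifs
      · ring
      · ring
  · refine le_trans (ENNReal.ofReal_le_ofReal ?_)
      (le_minimaxRisk_of_sparsityIneq hq0 hr hσ hm1 hmd (sparsityIneq_of_le hm1 hm.ge))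
    have : 0 ≤ σ ^ 2 * m * Real.log (1 + d / (m : ℝ) ^ 2) := by positivity
    linarith

lemma zero_case {d : ℕ} {q r σ : ℝ} (hq0 : 0 < q) (hq2 : q < 2) (hd : 1 ≤ d) (hr : 0 < r)
    (hσ : 0 < σ) (hm : effSparsity d q r σ = 0) :
    maxRisk σ l2Norm (lqBall d q r) (normStat d q r σ) ≤ ENNReal.ofReal (r ^ 2)
    ∧ ENNReal.ofReal (1 / 96 * r ^ 2) ≤ minimaxRisk σ l2Norm (lqBall d q r) := by
  constructor
  · refine iSup₂_le fun θ hθ => ?_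
    have h0 : ∀ y, normStat d q r σ y = 0 := by
      intro y
      simp [normStat, quadStat, hm]
    have : IsProbabilityMeasure (obsLaw σ θ) := by
      unfold obsLaw
      exact Measure.isProbabilityMeasure_map
        (Measurable.aemeasurable (by fun_prop))
    simp only [sqRisk, h0, lintegral_const, measure_univ, mul_one]
    apply ENNReal.ofReal_le_ofReal
    rw [zero_sub, neg_sq, l2Norm, Real.sq_sqrt (Finset.sum_nonneg fun j _ => sq_nonneg _)]
    exact sum_sq_le_of_mem hq0 hq2 hr hθ
  · have hfail : ¬ SparsityIneq d q r σ 1 := not_sparsityIneq_succ (m := 0) (by simpa using hm)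
    simp only [SparsityIneq, Nat.cast_one, Real.one_rpow, mul_one, not_le] at hfail
    -- One spike of height `r / 2`: failure at `1` means `r² < σ² log (1 + d)`, which is the
    -- undetectability condition for `a = r / (2σ)`.
    have h1 := le_minimaxRisk (d := d) (k := 1) (q := q) (r := r) (σ := σ) (a := r / (2 * σ))
      hq0 hσ hr le_rfl (by simpa using hd) (by positivity) ?_ ?_
    · refine le_trans (ENNReal.ofReal_le_ofReal ?_) h1
      have : σ ^ 2 * ((1 : ℕ) : ℝ) * (r / (2 * σ)) ^ 2 / 6 = r ^ 2 / 24 := by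
        push_cast; field_simp; norm_num
      rw [this]
      nlinarith [sq_nonneg r]
    · rw [div_pow, div_le_iff₀ (by positivity)]
      push_cast
      nlinarith
    · have : σ ^ 2 * (r / (2 * σ)) ^ 2 = r ^ 2 / 4 := by field_simp; norm_num
      rw [this]
      simp
      nlinarith [sq_nonneg r]

end SparseNorm

theorem theorem7 (q : ℝ) (hq0 : 0 < q) (hq2 : q < 2) :
    ∃ C c : ℝ, 0 < C ∧ 0 < c ∧
      ∀ (d : ℕ) (r σ : ℝ), 1 ≤ d → 0 < r → 0 < σ →
        Measurable (SparseNorm.normStat d q r σ) ∧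
        SparseNorm.maxRisk σ SparseNorm.l2Norm (SparseNorm.lqBall d q r)
            (SparseNorm.normStat d q r σ) ≤
          ENNReal.ofReal (C * SparseNorm.rate d q r σ) ∧
        ENNReal.ofReal (c * SparseNorm.rate d q r σ) ≤
          SparseNorm.minimaxRisk σ SparseNorm.l2Norm (SparseNorm.lqBall d q r) := by
  refine ⟨2 * (8192 + 1312 + 49154 ^ 2), 1 / 96, by norm_num, by norm_num,
    fun d r σ hd hr hσ => ⟨SparseNorm.measurable_normStat d q r σ, ?_⟩⟩
  unfold SparseNorm.rate
  split_ifs with h1 h2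
  · have h := SparseNorm.dense_case hq0 hd hr hσ h1
    refine ⟨h.1.trans (ENNReal.ofReal_le_ofReal ?_), h.2⟩
    have : 0 ≤ σ ^ 2 * √(d : ℝ) := by positivity
    nlinarith
  -- An infinite effective sparsity falls in the dense branch, so `toNat` loses nothing here.
  · have hne : SparseNorm.effSparsity d q r σ ≠ ⊤ := by
      intro htop
      rw [htop] at h1
      simp at h1
    obtain ⟨m, hm⟩ := ENat.ne_top_iff_exists.1 hne
    rw [← hm] at h1 h2 ⊢
    rw [ENat.toNat_natCast]
    exact SparseNorm.sparse_case hq0 hq2 hr hσ hm.symm (by exact_mod_cast h2)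
      (by rw [not_lt] at h1; exact_mod_cast h1)
  · have h := SparseNorm.zero_case hq0 hq2 hd hr hσ (Order.lt_one_iff.1 (not_le.1 h2))
    refine ⟨h.1.trans (ENNReal.ofReal_le_ofReal ?_), h.2⟩
    nlinarith [sq_nonneg r]
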